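/- Let $\gamma>0$ and let $\mathcal H=L^2(0,\pi)^3$ (complex-valued functions), with states written $z=(w,v,\theta)=(\partial_x u,\partial_t u,\theta)$. Let $\mathcal W$ be the generator of the weakly coupled thermoelastic system $\partial_t^2u-\partial_x^2u+\gamma\theta=0$, $\partial_t\theta-\partial_x^2\theta-\gamma\partial_tu=0$ on $(0,\pi)$, that is, the unbounded operator $$\mathcal W(w,v,\theta)=\bigl(\partial_x v,\ \partial_x w-\gamma\theta,\ \gamma v+\partial_x^2\theta\bigr)$$ on $\mathcal H$, whose domain consists of all $(w,v,\theta)\in H^1(0,\pi)\times H^1(0,\pi)\times H^2(0,\pi)$ that satisfy one of the four combinations (DD, DN, ND, NN) of the following boundary conditions at $x=0$ and $x=\pi$: for the displacement, Dirichlet ($u=0$, that is, $v=0$) or Neumann ($\partial_xu=w=0$); for the temperature, Dirichlet ($\theta=0$) or Neumann ($\partial_x\theta=0$). For each of the four cases, the spectrum of $\mathcal W$ (in particular, every eigenvalue) asymptotically lies along the imaginary axis and the negative real axis: for large $|\lambda|$, $\lambda\in\sigma(\mathcal W)$, one has $\lambda\sim in$ or $\lambda\sim-n^2$ for some large integer $n$.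 Precisely: for every $\varepsilon>0$ and every $N\in\mathbb N$ there is an $R$ such that for every $\lambda\in\sigma(\mathcal W)$ with $|\lambda|\ge R$, either there is an integer $n\neq0$ with $|n|\ge N$ and $$|\lambda-in|<\varepsilon,\qquad \Bigl|\frac{\lambda}{in}-1\Bigr|<\varepsilon,$$ or there is an integer $n\ge\max(N,1)$ with $$|\lambda+n^2|<\varepsilon,\qquad \Bigl|\frac{\lambda}{-n^2}-1\Bigr|<\varepsilon .$$ -/

import Mathlib

open MeasureTheory Set
open scoped ContDiff

namespace WeakThermo

/-- The complex Hilbert space `L²(0, π)`. -/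
abbrev L2 : Type := Lp ℂ 2 ((volume : Measure ℝ).restrict (Ioo 0 Real.pi))

/-- Test functions on `(0, π)`: smooth with compact support in the open interval. -/
def IsTest (φ : ℝ → ℝ) : Prop :=
  ContDiff ℝ ∞ φ ∧ HasCompactSupport φ ∧ tsupport φ ⊆ Ioo 0 Real.pi

/-- `g ∈ L²(0, π)` is the weak derivative of `f ∈ L²(0, π)`. -/
def IsWeakDeriv (f g : L2) : Prop :=
  ∀ φ : ℝ → ℝ, IsTest φ →
    ∫ x in Ioo 0 Real.pi, deriv φ x • f x = -∫ x in Ioo 0 Real.pi, φ x • g x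

/-- A bounded continuous real weight times an `L²` function is integrable on `(0, π)`. -/
theorem integrable_test_smul {φ : ℝ → ℝ} (hc : Continuous φ) (hs : HasCompactSupport φ) (f : L2) :
    Integrable (fun x => φ x • f x) ((volume : Measure ℝ).restrict (Ioo 0 Real.pi)) := by
  obtain ⟨C, hC⟩ := hs.exists_bound_of_continuous hc
  have hf : Integrable (f : ℝ → ℂ) ((volume : Measure ℝ).restrict (Ioo 0 Real.pi)) :=
    (Lp.memLp f).integrable (by norm_num)
  exact hf.bdd_smul C hc.aestronglyMeasurable (Filter.Eventually.of_forall hC)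

theorem IsTest.integrable_smul {φ : ℝ → ℝ} (h : IsTest φ) (f : L2) :
    Integrable (fun x => φ x • f x) ((volume : Measure ℝ).restrict (Ioo 0 Real.pi)) :=
  integrable_test_smul h.1.continuous h.2.1 f

theorem IsTest.integrable_deriv_smul {φ : ℝ → ℝ} (h : IsTest φ) (f : L2) :
    Integrable (fun x => deriv φ x • f x) ((volume : Measure ℝ).restrict (Ioo 0 Real.pi)) :=
  integrable_test_smul (h.1.continuous_deriv (by simp)) h.2.1.deriv f

theorem IsWeakDeriv.add {f₁ g₁ f₂ g₂ : L2} (h₁ : IsWeakDeriv f₁ g₁) (h₂ : IsWeakDeriv f₂ g₂) :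
    IsWeakDeriv (f₁ + f₂) (g₁ + g₂) := by
  intro φ hφ
  have e₁ : ∫ x in Ioo 0 Real.pi, deriv φ x • (f₁ + f₂ : L2) x
      = ∫ x in Ioo 0 Real.pi, (deriv φ x • f₁ x + deriv φ x • f₂ x) := by
    refine integral_congr_ae ?_
    filter_upwards [Lp.coeFn_add f₁ f₂] with x hx
    rw [hx, Pi.add_apply, smul_add]
  have e₂ : ∫ x in Ioo 0 Real.pi, φ x • (g₁ + g₂ : L2) x
      = ∫ x in Ioo 0 Real.pi, (φ x • g₁ x + φ x • g₂ x) := by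
    refine integral_congr_ae ?_
    filter_upwards [Lp.coeFn_add g₁ g₂] with x hx
    rw [hx, Pi.add_apply, smul_add]
  rw [e₁, e₂, integral_add (hφ.integrable_deriv_smul f₁) (hφ.integrable_deriv_smul f₂),
    integral_add (hφ.integrable_smul g₁) (hφ.integrable_smul g₂), h₁ φ hφ, h₂ φ hφ, neg_add]

theorem IsWeakDeriv.smul {f g : L2} (c : ℂ) (h : IsWeakDeriv f g) :
    IsWeakDeriv (c • f) (c • g) := by
  intro φ hφ
  have e₁ : ∫ x in Ioo 0 Real.pi, deriv φ x • (c • f : L2) x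
      = ∫ x in Ioo 0 Real.pi, c • (deriv φ x • f x) := by
    refine integral_congr_ae ?_
    filter_upwards [Lp.coeFn_smul c f] with x hx
    rw [hx, Pi.smul_apply, smul_comm]
  have e₂ : ∫ x in Ioo 0 Real.pi, φ x • (c • g : L2) x
      = ∫ x in Ioo 0 Real.pi, c • (φ x • g x) := by
    refine integral_congr_ae ?_
    filter_upwards [Lp.coeFn_smul c g] with x hx
    rw [hx, Pi.smul_apply, smul_comm]
  rw [e₁, e₂, integral_smul, integral_smul, h φ hφ, smul_neg]

theorem isWeakDeriv_zero : IsWeakDeriv 0 0 := by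
  simpa using (show IsWeakDeriv ((0 : ℂ) • (0 : L2)) ((0 : ℂ) • (0 : L2)) from by
    intro φ _
    have h0 : ∀ ψ : ℝ → ℝ, ∫ x in Ioo 0 Real.pi, ψ x • ((0 : ℂ) • (0 : L2) : L2) x = 0 := by
      intro ψ
      refine integral_eq_zero_of_ae ?_
      rw [smul_zero]
      filter_upwards [Lp.coeFn_zero ℂ 2 ((volume : Measure ℝ).restrict (Ioo 0 Real.pi))] with x hx
      rw [hx]
      simp
    rw [h0, h0, neg_zero])

/-- Weak derivatives are unique. -/
theorem IsWeakDeriv.unique {f g₁ g₂ : L2} (h₁ : IsWeakDeriv f g₁) (h₂ : IsWeakDeriv f g₂) :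
    g₁ = g₂ := by
  have h : IsWeakDeriv (f + (-1 : ℂ) • f) (g₁ + (-1 : ℂ) • g₂) := h₁.add (h₂.smul (-1))
  have hf : f + (-1 : ℂ) • f = 0 := by simp
  rw [hf] at h
  set g : L2 := g₁ + (-1 : ℂ) • g₂ with hg
  have hloc : LocallyIntegrableOn (g : ℝ → ℂ) (Ioo 0 Real.pi) volume := by
    have : IntegrableOn (g : ℝ → ℂ) (Ioo 0 Real.pi) volume :=
      (Lp.memLp g).integrable (by norm_num)
    exact this.locallyIntegrableOn
  have hae : ∀ᵐ x ∂(volume : Measure ℝ), x ∈ Ioo 0 Real.pi → g x = 0 := by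
    refine isOpen_Ioo.ae_eq_zero_of_integral_contDiff_smul_eq_zero hloc ?_
    intro φ hφ hc hs
    have h1 := h φ ⟨hφ, hc, hs⟩
    have h2 : ∫ x in Ioo 0 Real.pi, deriv φ x • (0 : L2) x = 0 := by
      refine integral_eq_zero_of_ae ?_
      filter_upwards [Lp.coeFn_zero ℂ 2 ((volume : Measure ℝ).restrict (Ioo 0 Real.pi))] with x hx
      rw [hx]
      simp
    rw [h2] at h1
    have h3 : ∫ x in Ioo 0 Real.pi, φ x • g x = ∫ x, φ x • g x := by
      refine setIntegral_eq_integral_of_forall_compl_eq_zero ?_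
      intro x hx
      have : φ x = 0 := by
        by_contra hne
        exact hx (hs (subset_tsupport φ hne))
      rw [this, zero_smul]
    rw [← h3]
    exact neg_eq_zero.mp h1.symm
  have hg0 : g = 0 := by
    rw [Lp.eq_zero_iff_ae_eq_zero]
    exact (ae_restrict_iff' measurableSet_Ioo).2 hae
  have : g₁ - g₂ = 0 := by
    rw [← hg0, hg]
    simp [sub_eq_add_neg]
  exact sub_eq_zero.mp this

/-- The Sobolev space `H¹(0, π)` as a subspace of `L²(0, π)`. -/
def H1 : Submodule ℂ L2 where
  carrier := {f | ∃ g, IsWeakDeriv f g}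
  add_mem' := by
    rintro f₁ f₂ ⟨g₁, h₁⟩ ⟨g₂, h₂⟩
    exact ⟨g₁ + g₂, h₁.add h₂⟩
  zero_mem' := ⟨0, isWeakDeriv_zero⟩
  smul_mem' := by
    rintro c f ⟨g, h⟩
    exact ⟨c • g, h.smul c⟩

open Classical in
/-- The weak derivative on `H¹(0, π)` (with the junk value `0` outside `H¹(0, π)`). -/
noncomputable def D (f : L2) : L2 := if h : ∃ g, IsWeakDeriv f g then h.choose else 0

theorem IsWeakDeriv.D_eq {f g : L2} (h : IsWeakDeriv f g) : D f = g := by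
  have hex : ∃ g, IsWeakDeriv f g := ⟨g, h⟩
  rw [D, dif_pos hex]
  exact hex.choose_spec.unique h

theorem isWeakDeriv_D {f : L2} (h : f ∈ H1) : IsWeakDeriv f (D f) := by
  obtain ⟨g, hg⟩ := h
  rw [hg.D_eq]
  exact hg

theorem D_add {f₁ f₂ : L2} (h₁ : f₁ ∈ H1) (h₂ : f₂ ∈ H1) : D (f₁ + f₂) = D f₁ + D f₂ :=
  ((isWeakDeriv_D h₁).add (isWeakDeriv_D h₂)).D_eq

theorem D_smul (c : ℂ) {f : L2} (h : f ∈ H1) : D (c • f) = c • D f :=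
  ((isWeakDeriv_D h).smul c).D_eq

theorem D_zero : D 0 = 0 := isWeakDeriv_zero.D_eq

/-- The Sobolev space `H²(0, π)` as a subspace of `L²(0, π)`. -/
def H2 : Submodule ℂ L2 where
  carrier := {f | f ∈ H1 ∧ D f ∈ H1}
  add_mem' := by
    rintro f₁ f₂ ⟨h₁, k₁⟩ ⟨h₂, k₂⟩
    refine ⟨H1.add_mem h₁ h₂, ?_⟩
    rw [D_add h₁ h₂]
    exact H1.add_mem k₁ k₂
  zero_mem' := by
    refine ⟨H1.zero_mem, ?_⟩
    rw [D_zero]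
    exact H1.zero_mem
  smul_mem' := by
    rintro c f ⟨h, k⟩
    refine ⟨H1.smul_mem c h, ?_⟩
    rw [D_smul c h]
    exact H1.smul_mem c k

/-- `f = 0` on the boundary `{0, π}`: the continuous representative of `f` on `[0, π]` (which is
unique, and exists for every `f ∈ H¹(0, π)`) vanishes at both end points. -/
def VanishesAtEnds (f : L2) : Prop :=
  ∃ F : ℝ → ℂ, ContinuousOn F (Icc 0 Real.pi) ∧
    f =ᵐ[(volume : Measure ℝ).restrict (Ioo 0 Real.pi)] F ∧ F 0 = 0 ∧ F Real.pi = 0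

theorem VanishesAtEnds.add {f g : L2} (hf : VanishesAtEnds f) (hg : VanishesAtEnds g) :
    VanishesAtEnds (f + g) := by
  obtain ⟨F, hFc, hF, hF0, hF1⟩ := hf
  obtain ⟨G, hGc, hG, hG0, hG1⟩ := hg
  refine ⟨F + G, hFc.add hGc, ?_, by simp [hF0, hG0], by simp [hF1, hG1]⟩
  filter_upwards [Lp.coeFn_add f g, hF, hG] with x hx h1 h2
  rw [hx, Pi.add_apply, Pi.add_apply, h1, h2]

theorem VanishesAtEnds.smul (c : ℂ) {f : L2} (hf : VanishesAtEnds f) :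
    VanishesAtEnds (c • f) := by
  obtain ⟨F, hFc, hF, hF0, hF1⟩ := hf
  refine ⟨c • F, hFc.const_smul c, ?_, by simp [hF0], by simp [hF1]⟩
  filter_upwards [Lp.coeFn_smul c f, hF] with x hx h1
  rw [hx, Pi.smul_apply, Pi.smul_apply, h1]

theorem vanishesAtEnds_zero : VanishesAtEnds 0 :=
  ⟨0, continuousOn_const, Lp.coeFn_zero ℂ 2 _, rfl, rfl⟩

/-- The two kinds of boundary condition. -/
inductive BC
  | dirichlet
  | neumann

/-- The state space `L²(0, π) × L²(0, π) × L²(0, π)` with its Hilbert norm; the components of a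
state `z` are `z 0 = ∂ₓu`, `z 1 = ∂ₜu` and `z 2 = θ`. -/
abbrev State : Type := PiLp 2 (fun _ : Fin 3 => L2)

/-- The boundary condition on the displacement `u`, for a state `z = (∂ₓu, ∂ₜu, θ)`.
Dirichlet (`u = 0` on the boundary) reads `∂ₜu = 0` there; Neumann reads `∂ₓu = 0` there. -/
def DisplacementBC : BC → State → Prop
  | BC.dirichlet, z => VanishesAtEnds (z 1)
  | BC.neumann, z => VanishesAtEnds (z 0)

/-- The boundary condition on the temperature `θ`: `θ = 0` or `∂ₓθ = 0` on the boundary. -/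
def TemperatureBC : BC → State → Prop
  | BC.dirichlet, z => VanishesAtEnds (z 2)
  | BC.neumann, z => VanishesAtEnds (D (z 2))

/-- The domain of the generator: `H¹ × H¹ × H²` with the chosen boundary conditions, `bu` for the
displacement and `bθ` for the temperature. -/
def generatorDomain (bu bθ : BC) : Submodule ℂ State where
  carrier := {z | z 0 ∈ H1 ∧ z 1 ∈ H1 ∧ z 2 ∈ H2 ∧ DisplacementBC bu z ∧ TemperatureBC bθ z}
  add_mem' := by
    rintro y z ⟨hy0, hy1, hy2, hyu, hyθ⟩ ⟨hz0, hz1, hz2, hzu, hzθ⟩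
    refine ⟨H1.add_mem hy0 hz0, H1.add_mem hy1 hz1, H2.add_mem hy2 hz2, ?_, ?_⟩
    · cases bu
      · exact VanishesAtEnds.add hyu hzu
      · exact VanishesAtEnds.add hyu hzu
    · cases bθ
      · exact VanishesAtEnds.add hyθ hzθ
      · change VanishesAtEnds (D (y 2 + z 2))
        rw [D_add hy2.1 hz2.1]
        exact VanishesAtEnds.add hyθ hzθ
  zero_mem' := by
    refine ⟨H1.zero_mem, H1.zero_mem, H2.zero_mem, ?_, ?_⟩
    · cases bu <;> exact vanishesAtEnds_zero
    · cases bθ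
      · exact vanishesAtEnds_zero
      · change VanishesAtEnds (D 0)
        rw [D_zero]
        exact vanishesAtEnds_zero
  smul_mem' := by
    rintro c z ⟨hz0, hz1, hz2, hzu, hzθ⟩
    refine ⟨H1.smul_mem c hz0, H1.smul_mem c hz1, H2.smul_mem c hz2, ?_, ?_⟩
    · cases bu
      · exact VanishesAtEnds.smul c hzu
      · exact VanishesAtEnds.smul c hzu
    · cases bθ
      · exact VanishesAtEnds.smul c hzθ
      · change VanishesAtEnds (D (c • z 2))
        rw [D_smul c hz2.1]
        exact VanishesAtEnds.smul c hzθ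

/-- The generator of the weakly coupled thermoelastic system with coupling constant `γ`,
`(w, v, θ) ↦ (∂ₓv, ∂ₓw - γ θ, γ v + ∂ₓ²θ)`, as an unbounded operator on the state space. -/
noncomputable def generator (bu bθ : BC) (γ : ℝ) : State →ₗ.[ℂ] State where
  domain := generatorDomain bu bθ
  toFun :=
    { toFun := fun z => WithLp.toLp 2
        ![D (z.1 1), D (z.1 0) - (γ : ℂ) • z.1 2, (γ : ℂ) • z.1 1 + D (D (z.1 2))]
      map_add' := by
        rintro ⟨y, hy0, hy1, hy2, -⟩ ⟨z, hz0, hz1, hz2, -⟩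
        refine PiLp.ext fun i => ?_
        fin_cases i
        · exact D_add hy1 hz1
        · change D (y 0 + z 0) - (γ : ℂ) • (y 2 + z 2)
            = (D (y 0) - (γ : ℂ) • y 2) + (D (z 0) - (γ : ℂ) • z 2)
          rw [D_add hy0 hz0, smul_add]
          abel
        · change (γ : ℂ) • (y 1 + z 1) + D (D (y 2 + z 2))
            = ((γ : ℂ) • y 1 + D (D (y 2))) + ((γ : ℂ) • z 1 + D (D (z 2)))
          rw [D_add hy2.1 hz2.1, D_add hy2.2 hz2.2, smul_add]
          abel
      map_smul' := by
        rintro c ⟨z, hz0, hz1, hz2, -⟩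
        refine PiLp.ext fun i => ?_
        fin_cases i
        · exact D_smul c hz1
        · change D (c • z 0) - (γ : ℂ) • (c • z 2) = c • (D (z 0) - (γ : ℂ) • z 2)
          rw [D_smul c hz0, smul_sub, smul_comm]
        · change (γ : ℂ) • (c • z 1) + D (D (c • z 2)) = c • ((γ : ℂ) • z 1 + D (D (z 2)))
          rw [D_smul c hz2.1, D_smul c hz2.2, smul_add, smul_comm] }

/-- The resolvent set of an unbounded operator `T`: those `μ` for which `μ - T`, from the domain
of `T` to the whole space, has a bounded everywhere defined two-sided inverse. -/
def resolventSetOf {E : Type*} [NormedAddCommGroup E] [NormedSpace ℂ E] (T : E →ₗ.[ℂ] E) : Set ℂ :=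
  {μ | ∃ R : E →L[ℂ] E,
    (∀ f : E, ∃ h : R f ∈ T.domain, μ • R f - T ⟨R f, h⟩ = f) ∧
    ∀ z : T.domain, R (μ • (z : E) - T z) = z}

/-- The spectrum of an unbounded operator: the complement of its resolvent set. -/
def spectrumOf {E : Type*} [NormedAddCommGroup E] [NormedSpace ℂ E] (T : E →ₗ.[ℂ] E) : Set ℂ :=
  (resolventSetOf T)ᶜ

end WeakThermo

/-! The operator is a bounded perturbation of a decoupled one. Without the coupling, the wave block
and the heat block are diagonal in sines and cosines chosen to fit the boundary conditions, with
spectra contained in iℤ and {-n²}. If μ has distance at least a from the first set and at least d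
from the second, each entry of the wave resolvent has norm at most 1/a, and the heat resolvent has
norm at most 1/d. In the mixed cases v and θ are expanded in different systems, so the full operator
is not block diagonal; only the boundedness of the coupling is used.

Write R₀ for the decoupled resolvent, C for the coupling and K = γ R₀ C. Since C feeds θ into the
wave equation and v into the heat equation, K exchanges the two blocks, and K² picks up one factor
from each: ‖K²‖ ≤ 2γ²/(ad). Hence 1 - K is invertible and μ lies in the resolvent set as soon as 2γ²
< ad (`mem_resolventSetOf_generator`). For large |μ| one of the two distances exceeds any prescribed
r, because the imaginary and the real axis separate (`norm_le_or_norm_le`). If μ is also ε-far from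
both sets, then ad ≥ rε > 2γ². So spectral points of large modulus are ε-close to one of the sets.

The analysis is reduced to algebra by `isWeakDeriv_pair_iff`, which encodes weak derivatives and
boundary conditions in Fourier coefficients. It rests on completeness of the sines and of the
cosines and on the du Bois-Reymond lemma. `IsFrame.exists_multiplier` then turns bounded symbols
into bounded operators. -/

namespace WeakThermo

/-! ### Multiplier operators between orthogonal systems -/

section DiagonalOperators

variable {E : Type*} [NormedAddCommGroup E] [InnerProductSpace ℂ E]

/-- A total orthogonal sequence whose members are unit vectors or zero. -/
structure IsFrame (e : ℕ → E) : Prop where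
  orth : Pairwise fun i j => inner ℂ (e i) (e j) = 0
  zero_or_norm : ∀ n, e n = 0 ∨ ‖e n‖ = 1
  total : ∀ f, (∀ n, inner ℂ (e n) f = 0) → f = 0

theorem IsFrame.ext {e : ℕ → E} (he : IsFrame e) {f g : E}
    (h : ∀ n, inner ℂ (e n) f = inner ℂ (e n) g) : f = g :=
  sub_eq_zero.1 (he.total _ fun n => by rw [inner_sub_right, h, sub_self])

theorem IsFrame.orthonormal_comp {e : ℕ → E} (he : IsFrame e) {p : ℕ → Prop}
    (hp : ∀ n, p n → e n ≠ 0) : Orthonormal ℂ fun j : {n // p n} => e j :=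
  ⟨fun j => (he.zero_or_norm j).resolve_left (hp j j.2),
    fun _ _ hij => he.orth fun h => hij (Subtype.ext h)⟩

/-- The operator mapping `e n` to `m n • e' n` for two frames `e`, `e'` and a bounded
multiplier `m`. -/
theorem IsFrame.exists_multiplier [CompleteSpace E] {e e' : ℕ → E} (he : IsFrame e)
    (he' : IsFrame e') {m : ℕ → ℂ} {C : ℝ} (hC : 0 ≤ C) (hm : ∀ n, ‖m n‖ ≤ C)
    (h0 : ∀ n, e' n = 0 → m n = 0 ∨ e n = 0) :
    ∃ M : E →L[ℂ] E, (∀ f, ‖M f‖ ≤ C * ‖f‖) ∧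
      ∀ f n, inner ℂ (e' n) (M f) = m n * inner ℂ (e n) f := by
  classical
  -- Zero members are allowed because sin(0·x) = 0. The isometries from ℓ² need orthonormal
  -- families, so only the indices where both members are nonzero are kept.
  let J := {n // e n ≠ 0 ∧ e' n ≠ 0}
  have on : Orthonormal ℂ fun j : J => e j := he.orthonormal_comp fun _ h => h.1
  have on' : Orthonormal ℂ fun j : J => e' j := he'.orthonormal_comp fun _ h => h.2
  let V : lp (fun _ : J => ℂ) 2 →ₗᵢ[ℂ] E := on.orthogonalFamily.linearIsometry
  let V' : lp (fun _ : J => ℂ) 2 →ₗᵢ[ℂ] E := on'.orthogonalFamily.linearIsometry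
  let T : ∀ j : J, ℂ →L[ℂ] ℂ := fun j => m j • ContinuousLinearMap.id ℂ ℂ
  have hT : ∀ j, ‖T j‖ ≤ C := fun j => by
    refine ContinuousLinearMap.opNorm_le_bound _ hC fun x => ?_
    simpa [T] using mul_le_mul_of_nonneg_right (hm j) (norm_nonneg x)
  -- The adjoint of the synthesis map V is the analysis map f ↦ (⟨e j, f⟩); the operator is
  -- analysis, multiplication by m, synthesis along e'.
  let A := ContinuousLinearMap.adjoint V.toContinuousLinearMap
  have hA : ∀ f (j : J), A f j = inner ℂ (e j) f := fun f j => by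
    have h1 : inner ℂ (lp.single 2 j (1 : ℂ)) (A f) = inner ℂ (V (lp.single 2 j (1 : ℂ))) f :=
      ContinuousLinearMap.adjoint_inner_right _ _ _
    rw [lp.inner_single_left] at h1
    have h2 : V (lp.single 2 j (1 : ℂ)) = e j := by
      simp [V, OrthogonalFamily.linearIsometry_apply_single]
    rw [h2] at h1
    simpa using h1
  have hAn : ‖A‖ ≤ 1 := by
    rw [LinearIsometryEquiv.norm_map]
    exact V.norm_toContinuousLinearMap_le
  let L := lp.mapCLM 2 T hC hT
  have hL : ‖L‖ ≤ C := lp.norm_mapCLM_le 2 T hC hT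
  refine ⟨V'.toContinuousLinearMap ∘L (L ∘L A), fun f => ?_, fun f n => ?_⟩
  · have : ‖V' (L (A f))‖ ≤ C * ‖f‖ := by
      rw [LinearIsometry.norm_map]
      refine (L.le_of_opNorm_le hL _).trans (mul_le_mul_of_nonneg_left ?_ hC)
      simpa using A.le_of_opNorm_le hAn f
    exact this
  · have hs : HasSum (fun j : J => inner ℂ (e' n) (e' j) * (m j * inner ℂ (e j) f))
        (inner ℂ (e' n) (V' (L (A f)))) := by
      have := (on'.orthogonalFamily.hasSum_linearIsometry (L (A f))).mapL (innerSL ℂ (e' n))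
      refine Eq.mp (congrArg (HasSum · _) (funext fun j => ?_)) this
      have : L (A f) j = m j * inner ℂ (e j) f := by
        rw [← hA]
        simp [L, T, lp.mapCLM]
      simp [this, mul_comm]
    change inner ℂ (e' n) (V' (L (A f))) = _
    by_cases hn : e n ≠ 0 ∧ e' n ≠ 0
    · refine hs.unique ?_
      have h1 : inner ℂ (e' n) (e' n) = 1 := by
        rw [inner_self_eq_norm_sq_to_K, (he'.zero_or_norm n).resolve_left hn.2]
        simp
      have h2 := hasSum_single (f := fun j : J => inner ℂ (e' n) (e' j) * (m j * inner ℂ (e j) f))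
        ⟨n, hn⟩ fun j hj => by rw [he'.orth fun h => hj (Subtype.ext h.symm), zero_mul]
      simpa only [h1, one_mul] using h2
    -- Off `J` both sides vanish: the right one by `h0` or because e n = 0, the left one because e'
    -- n is orthogonal to every e' j with j in `J`.
    · have hz : m n * inner ℂ (e n) f = 0 := by
        by_cases h : e n = 0
        · simp [h]
        · rcases h0 n (by tauto) with h' | h'
          · simp [h']
          · exact absurd h' h
      rw [hz]
      refine hs.unique ?_
      convert hasSum_zero using 2 with j
      rw [he'.orth (fun h => hn (by rw [h]; exact j.2)), zero_mul]

end DiagonalOperators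

/-! ### Orthogonality and completeness of sines and cosines on (0, π) -/

section TrigonometricFrames

theorem L2.integrable (f : L2) :
    Integrable (f : ℝ → ℂ) ((volume : Measure ℝ).restrict (Ioo 0 Real.pi)) :=
  (Lp.memLp f).integrable (by norm_num)

theorem exists_bound_Ioo {φ : ℝ → ℝ} (hφ : Continuous φ) :
    ∃ C, ∀ᵐ x ∂(volume : Measure ℝ).restrict (Ioo 0 Real.pi), ‖φ x‖ ≤ C := by
  obtain ⟨C, hC⟩ := isCompact_Icc.exists_bound_of_continuousOn (hφ.continuousOn (s := Icc 0 Real.pi))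
  exact ⟨C, (ae_restrict_iff' measurableSet_Ioo).2
    (Filter.Eventually.of_forall fun x hx => hC x (Ioo_subset_Icc_self hx))⟩

theorem integrable_continuous_smul {φ : ℝ → ℝ} (hφ : Continuous φ) (f : L2) :
    Integrable (fun x => φ x • f x) ((volume : Measure ℝ).restrict (Ioo 0 Real.pi)) := by
  obtain ⟨C, hC⟩ := exists_bound_Ioo hφ
  exact f.integrable.bdd_smul C hφ.aestronglyMeasurable hC

theorem eq_zero_of_forall_test {f : L2}
    (h : ∀ φ : ℝ → ℝ, IsTest φ → ∫ x in Ioo 0 Real.pi, φ x • f x = 0) : f = 0 := by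
  have hloc : LocallyIntegrableOn (f : ℝ → ℂ) (Ioo 0 Real.pi) volume :=
    IntegrableOn.locallyIntegrableOn f.integrable
  rw [Lp.eq_zero_iff_ae_eq_zero]
  refine (ae_restrict_iff' measurableSet_Ioo).2
    (isOpen_Ioo.ae_eq_zero_of_integral_contDiff_smul_eq_zero hloc fun φ hφ hc hs => ?_)
  rw [← h φ ⟨hφ, hc, hs⟩, eq_comm]
  refine setIntegral_eq_integral_of_forall_compl_eq_zero fun x hx => ?_
  rw [image_eq_zero_of_notMem_tsupport fun h' => hx (hs h'), zero_smul]

/-- The element of `L²(0, π)` given by a continuous function. -/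
noncomputable def ofContinuous (F : ℝ → ℂ) (hF : Continuous F) : L2 :=
  MemLp.toLp F <| by
    obtain ⟨C, hC⟩ := isCompact_Icc.exists_bound_of_continuousOn
      (hF.continuousOn (s := Icc 0 Real.pi))
    exact MemLp.of_bound hF.aestronglyMeasurable C ((ae_restrict_iff' measurableSet_Ioo).2
      (Filter.Eventually.of_forall fun x hx => hC x (Ioo_subset_Icc_self hx)))

theorem coeFn_ofContinuous (F : ℝ → ℂ) (hF : Continuous F) :
    ofContinuous F hF =ᵐ[(volume : Measure ℝ).restrict (Ioo 0 Real.pi)] F :=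
  MemLp.coeFn_toLp _

theorem inner_ofContinuous_ofReal {φ : ℝ → ℝ} (hφ : Continuous fun x => (φ x : ℂ)) (f : L2) :
    inner ℂ (ofContinuous (fun x => (φ x : ℂ)) hφ) f = ∫ x in Ioo 0 Real.pi, φ x • f x := by
  rw [L2.inner_def]
  refine integral_congr_ae ?_
  filter_upwards [coeFn_ofContinuous _ hφ] with x hx
  rw [hx, RCLike.inner_apply, Complex.conj_ofReal, Complex.real_smul, mul_comm]

theorem inner_ofContinuous_ofContinuous {φ ψ : ℝ → ℝ} (hφ : Continuous fun x => (φ x : ℂ))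
    (hψ : Continuous fun x => (ψ x : ℂ)) :
    inner ℂ (ofContinuous (fun x => (φ x : ℂ)) hφ) (ofContinuous (fun x => (ψ x : ℂ)) hψ) =
      ((∫ x in (0 : ℝ)..Real.pi, φ x * ψ x : ℝ) : ℂ) := by
  rw [inner_ofContinuous_ofReal, intervalIntegral.integral_of_le Real.pi_pos.le,
    integral_Ioc_eq_integral_Ioo, ← integral_complex_ofReal]
  refine integral_congr_ae ?_
  filter_upwards [coeFn_ofContinuous _ hψ] with x hx
  rw [hx, Complex.real_smul, Complex.ofReal_mul]

theorem integral_cos_int_mul {k : ℤ} (hk : k ≠ 0) :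
    ∫ x in (0 : ℝ)..Real.pi, Real.cos (k * x) = 0 := by
  have hk' : (k : ℝ) ≠ 0 := by exact_mod_cast hk
  rw [intervalIntegral.integral_comp_mul_left _ hk', integral_cos, Real.sin_int_mul_pi]
  simp

theorem integral_cos_mul_cos (m n : ℕ) :
    ∫ x in (0 : ℝ)..Real.pi, Real.cos (m * x) * Real.cos (n * x) =
      if m = n then (if n = 0 then Real.pi else Real.pi / 2) else 0 := by
  have h : ∀ x : ℝ, Real.cos (m * x) * Real.cos (n * x) =
      (Real.cos (((m - n : ℤ) : ℝ) * x) + Real.cos (((m + n : ℤ) : ℝ) * x)) / 2 := fun x => by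
    push_cast
    rw [sub_mul, add_mul, Real.cos_sub, Real.cos_add]
    ring
  have hi : ∀ k : ℤ, IntervalIntegrable (fun x : ℝ => Real.cos (k * x)) volume 0 Real.pi :=
    fun k => (by fun_prop : Continuous fun x : ℝ => Real.cos (k * x)).intervalIntegrable _ _
  simp_rw [h]
  rw [intervalIntegral.integral_div, intervalIntegral.integral_add (hi _) (hi _)]
  by_cases hmn : m = n
  · subst hmn
    by_cases hm : m = 0
    · simp [hm]
    · rw [integral_cos_int_mul (k := m + m) (by omega)]
      simp [hm]
  · rw [integral_cos_int_mul (by omega), integral_cos_int_mul (by omega)]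
    simp [hmn]

theorem integral_sin_mul_sin (m n : ℕ) :
    ∫ x in (0 : ℝ)..Real.pi, Real.sin (m * x) * Real.sin (n * x) =
      if m = n then (if n = 0 then 0 else Real.pi / 2) else 0 := by
  have h : ∀ x : ℝ, Real.sin (m * x) * Real.sin (n * x) =
      (Real.cos (((m - n : ℤ) : ℝ) * x) - Real.cos (((m + n : ℤ) : ℝ) * x)) / 2 := fun x => by
    push_cast
    rw [sub_mul, add_mul, Real.cos_sub, Real.cos_add]
    ring
  have hi : ∀ k : ℤ, IntervalIntegrable (fun x : ℝ => Real.cos (k * x)) volume 0 Real.pi :=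
    fun k => (by fun_prop : Continuous fun x : ℝ => Real.cos (k * x)).intervalIntegrable _ _
  simp_rw [h]
  rw [intervalIntegral.integral_div, intervalIntegral.integral_sub (hi _) (hi _)]
  by_cases hmn : m = n
  · subst hmn
    by_cases hm : m = 0
    · simp [hm]
    · rw [integral_cos_int_mul (k := m + m) (by omega)]
      simp [hm]
  · rw [integral_cos_int_mul (by omega), integral_cos_int_mul (by omega)]
    simp [hmn]

/-- The factor normalizing `cos (n x)` and, for `n ≠ 0`, `sin (n x)` in `L²(0, π)`. -/
noncomputable def trigScale (n : ℕ) : ℝ := if n = 0 then √(1 / Real.pi) else √(2 / Real.pi)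

theorem trigScale_ne_zero (n : ℕ) : trigScale n ≠ 0 := by
  have := Real.pi_pos
  unfold trigScale
  split_ifs <;> positivity

theorem trigScale_sq (n : ℕ) :
    trigScale n * trigScale n = if n = 0 then 1 / Real.pi else 2 / Real.pi := by
  have := Real.pi_pos
  unfold trigScale
  split_ifs <;> exact Real.mul_self_sqrt (by positivity)

noncomputable def cosFrame (n : ℕ) : L2 :=
  ofContinuous (fun x => ((trigScale n * Real.cos (n * x) : ℝ) : ℂ)) (by fun_prop)

noncomputable def sinFrame (n : ℕ) : L2 :=
  ofContinuous (fun x => ((trigScale n * Real.sin (n * x) : ℝ) : ℂ)) (by fun_prop)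

theorem inner_cosFrame (n : ℕ) (f : L2) :
    inner ℂ (cosFrame n) f =
      (trigScale n : ℂ) * ∫ x in Ioo 0 Real.pi, Real.cos (n * x) • f x := by
  rw [cosFrame, inner_ofContinuous_ofReal, ← Complex.real_smul, ← integral_smul]
  simp_rw [mul_smul]

theorem inner_sinFrame (n : ℕ) (f : L2) :
    inner ℂ (sinFrame n) f =
      (trigScale n : ℂ) * ∫ x in Ioo 0 Real.pi, Real.sin (n * x) • f x := by
  rw [sinFrame, inner_ofContinuous_ofReal, ← Complex.real_smul, ← integral_smul]
  simp_rw [mul_smul]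

theorem inner_cosFrame_cosFrame (m n : ℕ) :
    inner ℂ (cosFrame m) (cosFrame n) = if m = n then 1 else 0 := by
  have := Real.pi_pos
  rw [cosFrame, cosFrame, inner_ofContinuous_ofContinuous]
  have h : ∀ x : ℝ, trigScale m * Real.cos (m * x) * (trigScale n * Real.cos (n * x)) =
      trigScale m * trigScale n * (Real.cos (m * x) * Real.cos (n * x)) := fun x => by ring
  simp_rw [h]
  rw [intervalIntegral.integral_const_mul, integral_cos_mul_cos]
  split_ifs with h h'
  · subst h
    rw [trigScale_sq, if_pos h', one_div_mul_cancel this.ne', Complex.ofReal_one]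
  · subst h
    rw [trigScale_sq, if_neg h', div_mul_div_cancel₀ this.ne', div_self two_ne_zero,
      Complex.ofReal_one]
  · simp

theorem inner_sinFrame_sinFrame (m n : ℕ) :
    inner ℂ (sinFrame m) (sinFrame n) = if m = n ∧ n ≠ 0 then 1 else 0 := by
  have := Real.pi_pos
  rw [sinFrame, sinFrame, inner_ofContinuous_ofContinuous]
  have h : ∀ x : ℝ, trigScale m * Real.sin (m * x) * (trigScale n * Real.sin (n * x)) =
      trigScale m * trigScale n * (Real.sin (m * x) * Real.sin (n * x)) := fun x => by ring
  simp_rw [h]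
  rw [intervalIntegral.integral_const_mul, integral_sin_mul_sin]
  by_cases h : m = n
  · subst h
    by_cases h' : m = 0
    · simp [h']
    · rw [trigScale_sq, if_neg h', if_pos rfl, if_neg h', div_mul_div_cancel₀ this.ne',
        div_self two_ne_zero, Complex.ofReal_one, if_pos ⟨rfl, h'⟩]
  · simp [h]

theorem sinFrame_zero : sinFrame 0 = 0 := by
  rw [← inner_self_eq_zero (𝕜 := ℂ), inner_sinFrame_sinFrame]
  simp

theorem norm_eq_one_of_inner_self {f : L2} (h : inner ℂ f f = 1) : ‖f‖ = 1 := by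
  rw [norm_eq_sqrt_re_inner (𝕜 := ℂ), h, RCLike.one_re, Real.sqrt_one]

theorem norm_sinFrame {n : ℕ} (hn : n ≠ 0) : ‖sinFrame n‖ = 1 :=
  norm_eq_one_of_inner_self (by rw [inner_sinFrame_sinFrame, if_pos ⟨rfl, hn⟩])

theorem norm_cosFrame (n : ℕ) : ‖cosFrame n‖ = 1 :=
  norm_eq_one_of_inner_self (by rw [inner_cosFrame_cosFrame, if_pos rfl])

/-- By the product formula f is orthogonal to every cosᵏ x cos(nx), hence to every polynomial in cos
x. A test function is a continuous function of cos x on (0, π), so Weierstrass approximation shows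
that f is orthogonal to it as well. -/
theorem eq_zero_of_cos_coeff {f : L2}
    (h : ∀ n : ℕ, ∫ x in Ioo 0 Real.pi, Real.cos (n * x) • f x = 0) : f = 0 := by
  have hpow : ∀ (k : ℕ) (n : ℤ),
      ∫ x in Ioo 0 Real.pi, (Real.cos x ^ k * Real.cos (n * x)) • f x = 0 := by
    intro k
    induction k with
    | zero =>
      intro n
      rw [← h n.natAbs]
      refine integral_congr_ae (Filter.Eventually.of_forall fun x => ?_)
      rcases Int.natAbs_eq n with hn | hn <;> dsimp only <;> rw [hn] <;> simp
    | succ k ih =>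
      intro n
      have h2 : ∀ x : ℝ, (Real.cos x ^ (k + 1) * Real.cos (n * x)) • f x =
          (2⁻¹ : ℝ) • ((Real.cos x ^ k * Real.cos (((n + 1 : ℤ) : ℝ) * x)) • f x +
            (Real.cos x ^ k * Real.cos (((n - 1 : ℤ) : ℝ) * x)) • f x) := fun x => by
        rw [← add_smul, smul_smul]
        congr 1
        push_cast
        rw [sub_mul, add_mul, one_mul, Real.cos_sub, Real.cos_add]
        ring
      simp_rw [h2]
      rw [integral_smul, integral_add (integrable_continuous_smul (by fun_prop) f)
        (integrable_continuous_smul (by fun_prop) f), ih, ih, add_zero, smul_zero]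
  have hpoly : ∀ p : Polynomial ℝ, ∫ x in Ioo 0 Real.pi, p.eval (Real.cos x) • f x = 0 := by
    intro p
    simp_rw [Polynomial.eval_eq_sum_range, Finset.sum_smul]
    rw [integral_finsetSum _ fun k _ => integrable_continuous_smul (by fun_prop) f]
    refine Finset.sum_eq_zero fun k _ => ?_
    simp_rw [mul_smul]
    rw [integral_smul]
    have := hpow k 0
    simp only [Int.cast_zero, zero_mul, Real.cos_zero, mul_one] at this
    rw [this, smul_zero]
  refine eq_zero_of_forall_test fun φ hφ => ?_
  refine norm_le_zero_iff.1 (le_of_forall_pos_le_add fun ε hε => ?_)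
  set K := ∫ x in Ioo 0 Real.pi, ‖f x‖ with hK
  have hK0 : 0 ≤ K := integral_nonneg fun _ => norm_nonneg _
  -- The tolerance makes the final error ε K / (K + 1) ≤ ε; the summand 1 covers K = 0.
  obtain ⟨p, hp⟩ := exists_polynomial_near_of_continuousOn (-1) 1 (fun y => φ (Real.arccos y))
    ((hφ.1.continuous.comp Real.continuous_arccos).continuousOn) (ε / (K + 1)) (by positivity)
  have hφp : ∫ x in Ioo 0 Real.pi, φ x • f x =
      ∫ x in Ioo 0 Real.pi, (φ x - p.eval (Real.cos x)) • f x := by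
    simp_rw [sub_smul]
    rw [integral_sub (integrable_continuous_smul hφ.1.continuous f)
      (integrable_continuous_smul (by fun_prop) f), hpoly, sub_zero]
  rw [hφp]
  have hle : ‖∫ x in Ioo 0 Real.pi, (φ x - p.eval (Real.cos x)) • f x‖ ≤
      ∫ x in Ioo 0 Real.pi, ε / (K + 1) * ‖f x‖ := by
    refine norm_integral_le_of_norm_le (f.integrable.norm.const_mul _)
      ((ae_restrict_iff' measurableSet_Ioo).2 (Filter.Eventually.of_forall fun x hx => ?_))
    rw [norm_smul, Real.norm_eq_abs]
    refine mul_le_mul_of_nonneg_right ?_ (norm_nonneg _)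
    have := hp (Real.cos x) ⟨Real.neg_one_le_cos x, Real.cos_le_one x⟩
    rw [Real.arccos_cos hx.1.le hx.2.le, abs_sub_comm] at this
    exact this.le
  rw [integral_const_mul, ← hK] at hle
  refine hle.trans ?_
  rw [zero_add, div_mul_eq_mul_div, div_le_iff₀ (by positivity)]
  nlinarith

/-- The cosine coefficients of sin x · f(x) are half differences of sine coefficients of f, so this
product is zero; sin is positive on (0, π). -/
theorem eq_zero_of_sin_coeff {f : L2}
    (h : ∀ n : ℕ, ∫ x in Ioo 0 Real.pi, Real.sin (n * x) • f x = 0) : f = 0 := by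
  have hm : MemLp (fun x => Real.sin x • f x) 2 ((volume : Measure ℝ).restrict (Ioo 0 Real.pi)) := by
    refine (Lp.memLp f).of_le
      (Real.continuous_sin.aestronglyMeasurable.smul (Lp.aestronglyMeasurable f))
      (Filter.Eventually.of_forall fun x => ?_)
    rw [norm_smul]
    exact mul_le_of_le_one_left (norm_nonneg _) (Real.abs_sin_le_one x)
  have hg : hm.toLp _ = 0 := by
    refine eq_zero_of_cos_coeff fun n => ?_
    have e : ∫ x in Ioo 0 Real.pi, Real.cos (n * x) • (hm.toLp _ : L2) x =
        ∫ x in Ioo 0 Real.pi, (2⁻¹ : ℝ) • (Real.sin ((n + 1 : ℕ) * x) • f x -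
          Real.sin (((n : ℝ) - 1) * x) • f x) := by
      refine integral_congr_ae ?_
      filter_upwards [hm.coeFn_toLp] with x hx
      rw [hx, ← sub_smul, smul_smul, smul_smul]
      congr 1
      push_cast
      rw [sub_mul, add_mul, one_mul, Real.sin_sub, Real.sin_add]
      ring
    -- For n = 0 the real frequency n - 1 gives -sin x, which is covered by the hypothesis at 1.
    have hn : ∫ x in Ioo 0 Real.pi, Real.sin (((n : ℝ) - 1) * x) • f x = 0 := by
      rcases n with _ | n
      · have := h 1
        simp only [Nat.cast_one, one_mul] at this
        simp only [Nat.cast_zero, zero_sub, neg_mul, one_mul, Real.sin_neg, neg_smul]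
        rw [integral_neg, this, neg_zero]
      · simpa using h n
    rw [e, integral_smul, integral_sub (integrable_continuous_smul (by fun_prop) f)
      (integrable_continuous_smul (by fun_prop) f), h, hn, sub_zero, smul_zero]
  rw [Lp.eq_zero_iff_ae_eq_zero] at hg ⊢
  filter_upwards [hg, hm.coeFn_toLp, ae_restrict_mem measurableSet_Ioo] with x h1 h2 hx
  rw [h2] at h1
  exact (smul_eq_zero.1 h1).resolve_left (Real.sin_pos_of_mem_Ioo hx).ne'

theorem isFrame_cosFrame : IsFrame cosFrame where
  orth m n hmn := by simp [inner_cosFrame_cosFrame, hmn]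
  zero_or_norm n := .inr (norm_cosFrame n)
  total f hf := eq_zero_of_cos_coeff fun n => by
    have := hf n
    rw [inner_cosFrame] at this
    exact (mul_eq_zero.1 this).resolve_left (by exact_mod_cast trigScale_ne_zero n)

theorem isFrame_sinFrame : IsFrame sinFrame where
  orth m n hmn := by simp [inner_sinFrame_sinFrame, hmn]
  zero_or_norm n := by
    rcases eq_or_ne n 0 with rfl | hn
    · exact .inl sinFrame_zero
    · exact .inr (norm_sinFrame hn)
  total f hf := eq_zero_of_sin_coeff fun n => by
    have := hf n
    rw [inner_sinFrame] at this
    exact (mul_eq_zero.1 this).resolve_left (by exact_mod_cast trigScale_ne_zero n)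

end TrigonometricFrames

/-! ### Weak derivatives, boundary values and Fourier coefficients -/

section WeakDerivatives

/-- The primitive vanishing at `0`. -/
noncomputable def prim (g : L2) (x : ℝ) : ℂ :=
  ∫ y in (0 : ℝ)..x, (Ioo 0 Real.pi).indicator g y

theorem continuous_prim (g : L2) : Continuous (prim g) := by
  have h : Integrable ((Ioo 0 Real.pi).indicator g) volume :=
    (integrable_indicator_iff measurableSet_Ioo).2 g.integrable
  exact intervalIntegral.continuous_primitive (fun _ _ => h.intervalIntegrable) 0

theorem prim_zero (g : L2) : prim g 0 = 0 := intervalIntegral.integral_same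

theorem prim_eq_setIntegral (g : L2) {x : ℝ} (hx : 0 ≤ x) :
    prim g x = ∫ y in Ioo 0 Real.pi, (Iic x).indicator g y := by
  rw [prim, intervalIntegral.integral_of_le hx, setIntegral_indicator measurableSet_Ioo,
    setIntegral_indicator measurableSet_Iic]
  congr 2
  ext y
  simp only [mem_inter_iff, mem_Ioc, mem_Ioo, mem_Iic]
  tauto

theorem prim_pi (g : L2) : prim g Real.pi = ∫ y in Ioo 0 Real.pi, g y := by
  rw [prim_eq_setIntegral g Real.pi_pos.le, setIntegral_indicator measurableSet_Iic]
  congr 2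
  exact inter_eq_left.2 fun y hy => hy.2.le

/-- Fubini on the triangle y ≤ x: the inner integral of ψ' over [y, π] is ψ(π) - ψ(y). There is no
term at 0 because `prim g` vanishes there. -/
theorem integral_deriv_smul_prim {ψ ψ' : ℝ → ℝ} (hψ : ∀ x, HasDerivAt ψ (ψ' x) x)
    (hψ' : Continuous ψ') (g : L2) :
    ∫ x in Ioo 0 Real.pi, ψ' x • prim g x =
      ψ Real.pi • prim g Real.pi - ∫ x in Ioo 0 Real.pi, ψ x • g x := by
  set μ := (volume : Measure ℝ).restrict (Ioo 0 Real.pi) with hμ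
  have hψc : Continuous ψ := continuous_iff_continuousAt.2 fun x => (hψ x).continuousAt
  have hψi : Integrable ψ' μ := (hψ'.integrableOn_Icc (a := 0) (b := Real.pi)).mono_set
    Ioo_subset_Icc_self
  let F : ℝ → ℝ → ℂ := fun x y => {p : ℝ × ℝ | p.2 ≤ p.1}.indicator
    (fun p => ψ' p.1 • g p.2) (x, y)
  have hF : Integrable (Function.uncurry F) (μ.prod μ) :=
    (hψi.smul_prod g.integrable).indicator (measurableSet_le measurable_snd measurable_fst)
  have h1 : ∫ x in Ioo 0 Real.pi, ψ' x • prim g x = ∫ x, ∫ y, F x y ∂μ ∂μ := by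
    refine setIntegral_congr_fun measurableSet_Ioo fun x hx => ?_
    rw [prim_eq_setIntegral g hx.1.le, ← integral_smul]
    refine integral_congr_ae (Filter.Eventually.of_forall fun y => ?_)
    by_cases h : y ≤ x <;> simp [F, h]
  have h2 : ∫ y, ∫ x, F x y ∂μ ∂μ =
      ∫ y in Ioo 0 Real.pi, (ψ Real.pi • g y - ψ y • g y) := by
    refine setIntegral_congr_fun measurableSet_Ioo fun y hy => ?_
    have e : ∀ x, F x y = (Ici y).indicator ψ' x • g y := fun x => by
      by_cases h : y ≤ x <;> simp [F, h]
    simp_rw [e]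
    rw [integral_smul_const, ← sub_smul, hμ, setIntegral_indicator measurableSet_Ici]
    have hs : Ioo 0 Real.pi ∩ Ici y = Ico y Real.pi := by
      ext x
      simp only [mem_inter_iff, mem_Ioo, mem_Ici, mem_Ico]
      have := hy.1
      exact ⟨fun h => ⟨h.2, h.1.2⟩, fun h => ⟨⟨by linarith, h.2⟩, h.1⟩⟩
    rw [hs, integral_Ico_eq_integral_Ioo, ← integral_Ioc_eq_integral_Ioo,
      ← intervalIntegral.integral_of_le hy.2.le,
      intervalIntegral.integral_eq_sub_of_hasDerivAt (fun x _ => hψ x)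
        (hψ'.intervalIntegrable _ _)]
  rw [h1, integral_integral_swap hF, h2,
    integral_sub (g.integrable.fun_smul (ψ Real.pi)) (integrable_continuous_smul hψc g), integral_smul,
    prim_pi]

theorem IsTest.apply_eq_zero {φ : ℝ → ℝ} (hφ : IsTest φ) {x : ℝ} (hx : x ∉ Ioo 0 Real.pi) :
    φ x = 0 :=
  image_eq_zero_of_notMem_tsupport fun h => hx (hφ.2.2 h)

theorem IsTest.hasDerivAt {φ : ℝ → ℝ} (hφ : IsTest φ) (x : ℝ) : HasDerivAt φ (deriv φ x) x :=
  (hφ.1.differentiable (by simp) x).hasDerivAt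

theorem IsTest.continuous_deriv {φ : ℝ → ℝ} (hφ : IsTest φ) : Continuous (deriv φ) :=
  hφ.1.continuous_deriv (by simp)

noncomputable def primL2 (g : L2) : L2 := ofContinuous (prim g) (continuous_prim g)

theorem isWeakDeriv_primL2 (g : L2) : IsWeakDeriv (primL2 g) g := by
  intro φ hφ
  have e : ∫ x in Ioo 0 Real.pi, deriv φ x • primL2 g x =
      ∫ x in Ioo 0 Real.pi, deriv φ x • prim g x := by
    refine integral_congr_ae ?_
    filter_upwards [coeFn_ofContinuous _ (continuous_prim g)] with x hx
    rw [primL2, hx]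
  rw [e, integral_deriv_smul_prim hφ.hasDerivAt hφ.continuous_deriv,
    hφ.apply_eq_zero (by simp), zero_smul, zero_sub]

noncomputable def constL2 (c : ℂ) : L2 := ofContinuous (fun _ => c) continuous_const

theorem coeFn_constL2 (c : ℂ) :
    constL2 c =ᵐ[(volume : Measure ℝ).restrict (Ioo 0 Real.pi)] fun _ => c :=
  coeFn_ofContinuous _ _

theorem isWeakDeriv_constL2 (c : ℂ) : IsWeakDeriv (constL2 c) 0 := by
  intro φ hφ
  have e : ∫ x in Ioo 0 Real.pi, deriv φ x • constL2 c x =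
      (∫ x in Ioo 0 Real.pi, deriv φ x) • c := by
    rw [← integral_smul_const]
    refine integral_congr_ae ?_
    filter_upwards [coeFn_constL2 c] with x hx
    rw [hx]
  have e0 : ∫ x in Ioo 0 Real.pi, φ x • (0 : L2) x = 0 := by
    refine integral_eq_zero_of_ae ?_
    filter_upwards [Lp.coeFn_zero ℂ 2 ((volume : Measure ℝ).restrict (Ioo 0 Real.pi))] with x hx
    rw [hx]
    simp
  rw [e, e0, ← integral_Ioc_eq_integral_Ioo, ← intervalIntegral.integral_of_le Real.pi_pos.le,
    intervalIntegral.integral_eq_sub_of_hasDerivAt (fun x _ => hφ.hasDerivAt x)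
      (hφ.continuous_deriv.intervalIntegrable _ _),
    hφ.apply_eq_zero (by simp), hφ.apply_eq_zero (by simp)]
  simp

theorem exists_isTest_integral_eq_one : ∃ χ, IsTest χ ∧ ∫ x, χ x = 1 := by
  have hp := Real.pi_gt_three
  let b : ContDiffBump (Real.pi / 2) := ⟨1 / 2, 1, by norm_num, by norm_num⟩
  refine ⟨b.normed volume, ⟨b.contDiff_normed, b.hasCompactSupport_normed, ?_⟩, b.integral_normed⟩
  rw [b.tsupport_normed_eq, Real.closedBall_eq_Icc]
  exact Icc_subset_Ioo (by simp only [b]; linarith) (by simp only [b]; linarith)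

/-- A test function of integral zero is the derivative of a test function. -/
theorem IsTest.exists_deriv_eq {η : ℝ → ℝ} (hη : IsTest η) (h0 : ∫ x, η x = 0) :
    ∃ φ, IsTest φ ∧ deriv φ = η := by
  have hc := hη.1.continuous
  -- The extra point keeps the compact set nonempty when η = 0, so that its extrema a and b exist.
  let K := insert (Real.pi / 2) (tsupport η)
  have hK : IsCompact K := hη.2.1.isCompact.insert _
  have hKs : K ⊆ Ioo 0 Real.pi :=
    insert_subset ⟨by linarith [Real.pi_pos], by linarith [Real.pi_pos]⟩ hη.2.2
  obtain ⟨a, haK, ha⟩ := hK.exists_isLeast (insert_nonempty _ _)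
  obtain ⟨b, hbK, hb⟩ := hK.exists_isGreatest (insert_nonempty _ _)
  have hout : ∀ x, x ∉ Icc a b → η x = 0 := fun x hx =>
    image_eq_zero_of_notMem_tsupport fun h =>
      hx ⟨ha (mem_insert_of_mem _ h), hb (mem_insert_of_mem _ h)⟩
  let φ : ℝ → ℝ := fun x => ∫ y in a..x, η y
  have hd : ∀ x, HasDerivAt φ (η x) x := fun x =>
    intervalIntegral.integral_hasDerivAt_right (hc.intervalIntegrable _ _)
      hc.stronglyMeasurable.stronglyMeasurableAtFilter hc.continuousAt
  have hderiv : deriv φ = η := funext fun x => (hd x).deriv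
  have hsupp : Function.support φ ⊆ Icc a b := by
    intro x hx
    by_contra hxI
    apply hx
    -- Left of a the integrand is zero; right of b the primitive equals the full integral of η,
    -- which is zero.
    rcases lt_or_ge x a with hxa | hxa
    · have : ∫ y in a..x, η y = ∫ y in a..x, (0 : ℝ) := by
        refine intervalIntegral.integral_congr_uIoo fun y hy => ?_
        rw [uIoo_of_ge hxa.le] at hy
        exact hout y fun h => absurd h.1 (not_le.2 hy.2)
      simp only [φ, this, intervalIntegral.integral_zero]
    · have hbx : b < x := lt_of_not_ge fun h => hxI ⟨hxa, h⟩
      simp only [φ]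
      rw [intervalIntegral.integral_of_le hxa, ← h0, ← integral_Icc_eq_integral_Ioc]
      exact setIntegral_eq_integral_of_forall_compl_eq_zero fun y hy =>
        hout y fun h => hy ⟨h.1, h.2.trans hbx.le⟩
  have hts : tsupport φ ⊆ Icc a b := closure_minimal hsupp isClosed_Icc
  refine ⟨φ, ⟨?_, HasCompactSupport.of_support_subset_isCompact isCompact_Icc hsupp,
    hts.trans (Icc_subset_Ioo (hKs haK).1 (hKs hbK).2)⟩, hderiv⟩
  rw [contDiff_infty_iff_deriv, hderiv]
  exact ⟨fun x => (hd x).differentiableAt, hη.1⟩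

theorem IsTest.sub {φ ψ : ℝ → ℝ} (hφ : IsTest φ) (hψ : IsTest ψ) (c : ℝ) :
    IsTest (fun x => φ x - c * ψ x) := by
  have hc : HasCompactSupport fun x => c * ψ x := hψ.2.1.mul_left (f := fun _ => c)
  refine ⟨hφ.1.sub (contDiff_const.mul hψ.1), hφ.2.1.sub hc, ?_⟩
  refine (tsupport_sub _ _).trans (union_subset hφ.2.2 ?_)
  exact (tsupport_mul_subset_right (f := fun _ => c) (g := ψ)).trans hψ.2.2

/-- The lemma of du Bois-Reymond. -/
theorem IsWeakDeriv.eq_constL2 {h : L2} (hh : IsWeakDeriv h 0) : ∃ c, h = constL2 c := by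
  obtain ⟨χ, hχ, hχ1⟩ := exists_isTest_integral_eq_one
  set c : ℂ := ∫ x in Ioo 0 Real.pi, χ x • h x with hc
  refine ⟨c, sub_eq_zero.1 (eq_zero_of_forall_test fun ψ hψ => ?_)⟩
  set s := ∫ x, ψ x with hs
  have hint : ∀ {φ : ℝ → ℝ}, IsTest φ → Integrable φ := fun hφ =>
    hφ.1.continuous.integrable_of_hasCompactSupport hφ.2.1
  -- Subtracting s χ makes the integral zero, so ψ - s χ is an admissible derivative to test
  -- against.
  obtain ⟨φ, hφ, hφd⟩ := (hψ.sub hχ s).exists_deriv_eq (by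
    rw [integral_sub (hint hψ) ((hint hχ).const_mul s), integral_const_mul, hχ1, mul_one, sub_self])
  have h1 := hh φ hφ
  have h0 : ∫ x in Ioo 0 Real.pi, φ x • (0 : L2) x = 0 := by
    refine integral_eq_zero_of_ae ?_
    filter_upwards [Lp.coeFn_zero ℂ 2 ((volume : Measure ℝ).restrict (Ioo 0 Real.pi))] with x hx
    rw [hx]
    simp
  rw [h0, hφd, neg_zero] at h1
  simp_rw [sub_smul, mul_smul] at h1
  rw [integral_sub (hψ.integrable_smul h) ((hχ.integrable_smul h).fun_smul s), integral_smul, ← hc]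
    at h1
  have e : ∫ x in Ioo 0 Real.pi, ψ x • (h - constL2 c : L2) x =
      ∫ x in Ioo 0 Real.pi, (ψ x • h x - ψ x • c) := by
    refine integral_congr_ae ?_
    filter_upwards [Lp.coeFn_sub h (constL2 c), coeFn_constL2 c] with x hx hx'
    rw [hx, Pi.sub_apply, hx', smul_sub]
  have hs' : ∫ x in Ioo 0 Real.pi, ψ x = s :=
    setIntegral_eq_integral_of_forall_compl_eq_zero fun x hx => hψ.apply_eq_zero hx
  rw [e, integral_sub (hψ.integrable_smul h) ((hint hψ).integrableOn.smul_const c),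
    integral_smul_const, hs', h1]

theorem IsWeakDeriv.sub {f₁ g₁ f₂ g₂ : L2} (h₁ : IsWeakDeriv f₁ g₁) (h₂ : IsWeakDeriv f₂ g₂) :
    IsWeakDeriv (f₁ - f₂) (g₁ - g₂) := by
  simpa [sub_eq_add_neg] using h₁.add (h₂.smul (-1))

theorem IsWeakDeriv.exists_eq_add_primL2 {f g : L2} (h : IsWeakDeriv f g) :
    ∃ c, f = constL2 c + primL2 g := by
  have := h.sub (isWeakDeriv_primL2 g)
  rw [sub_self] at this
  obtain ⟨c, hc⟩ := this.eq_constL2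
  exact ⟨c, by rw [← hc, sub_add_cancel]⟩

theorem coeFn_constL2_add_primL2 (c : ℂ) (g : L2) :
    (constL2 c + primL2 g : L2) =ᵐ[(volume : Measure ℝ).restrict (Ioo 0 Real.pi)]
      fun x => c + prim g x := by
  filter_upwards [Lp.coeFn_add (constL2 c) (primL2 g), coeFn_constL2 c,
    coeFn_ofContinuous _ (continuous_prim g)] with x h1 h2 h3
  rw [h1, Pi.add_apply, h2, primL2, h3]

/-- Integration by parts for a weakly differentiable function with continuous
representative `c + prim g`. -/
theorem integral_deriv_smul_eq {ψ ψ' : ℝ → ℝ} (hψ : ∀ x, HasDerivAt ψ (ψ' x) x)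
    (hψ' : Continuous ψ') (c : ℂ) (g : L2) :
    ∫ x in Ioo 0 Real.pi, ψ' x • (constL2 c + primL2 g : L2) x =
      ψ Real.pi • (c + prim g Real.pi) - ψ 0 • c - ∫ x in Ioo 0 Real.pi, ψ x • g x := by
  have hi : ∀ {F : ℝ → ℂ}, Continuous F →
      Integrable (fun x => ψ' x • F x) ((volume : Measure ℝ).restrict (Ioo 0 Real.pi)) := fun hF =>
    ((hψ'.smul hF).integrableOn_Icc (a := 0) (b := Real.pi)).mono_set Ioo_subset_Icc_self
  have e : ∫ x in Ioo 0 Real.pi, ψ' x • (constL2 c + primL2 g : L2) x =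
      ∫ x in Ioo 0 Real.pi, (ψ' x • c + ψ' x • prim g x) := by
    refine integral_congr_ae ?_
    filter_upwards [coeFn_constL2_add_primL2 c g] with x hx
    rw [hx, smul_add]
  rw [e, integral_add (hi continuous_const) (hi (continuous_prim g)), integral_smul_const,
    integral_deriv_smul_prim hψ hψ', ← integral_Ioc_eq_integral_Ioo,
    ← intervalIntegral.integral_of_le Real.pi_pos.le,
    intervalIntegral.integral_eq_sub_of_hasDerivAt (fun x _ => hψ x) (hψ'.intervalIntegrable _ _),
    sub_smul, smul_add]
  abel

/-- Two continuous functions that agree almost everywhere on (0, π) agree on [0, π], so the end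
values may be read off from c + `prim g`. -/
theorem VanishesAtEnds.of_eq {c : ℂ} {g : L2} (h : VanishesAtEnds (constL2 c + primL2 g)) :
    c = 0 ∧ prim g Real.pi = 0 := by
  obtain ⟨F, hFc, hF, hF0, hF1⟩ := h
  have hae : F =ᵐ[(volume : Measure ℝ).restrict (Icc 0 Real.pi)] fun x => c + prim g x := by
    rw [← restrict_Ioo_eq_restrict_Icc]
    exact hF.symm.trans (coeFn_constL2_add_primL2 c g)
  have heq := Measure.eqOn_Icc_of_ae_eq _ Real.pi_pos.ne hae hFc
    (continuous_const.add (continuous_prim g)).continuousOn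
  have h0 := heq ⟨le_rfl, Real.pi_pos.le⟩
  have h1 := heq ⟨Real.pi_pos.le, le_rfl⟩
  simp only [hF0, prim_zero, add_zero] at h0
  simp only [hF1, ← h0, zero_add] at h1
  exact ⟨h0.symm, h1.symm⟩

theorem hasDerivAt_sin_nat_mul (n : ℕ) (x : ℝ) :
    HasDerivAt (fun x : ℝ => Real.sin (n * x)) (n * Real.cos (n * x)) x := by
  simpa [mul_comm (n : ℝ)] using (hasDerivAt_mul_const (n : ℝ)).sin (x := x)

theorem hasDerivAt_cos_nat_mul (n : ℕ) (x : ℝ) :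
    HasDerivAt (fun x : ℝ => Real.cos (n * x)) (-(n * Real.sin (n * x))) x := by
  simpa [mul_comm (n : ℝ)] using (hasDerivAt_mul_const (n : ℝ)).cos (x := x)

/-- Sines vanish at both ends, so integration by parts leaves no boundary term and f needs no
boundary condition. Against cosines, f itself must vanish there. -/
theorem IsWeakDeriv.inner_sinFrame {f g : L2} (h : IsWeakDeriv f g) (n : ℕ) :
    inner ℂ (sinFrame n) g = -n * inner ℂ (cosFrame n) f := by
  obtain ⟨c, rfl⟩ := h.exists_eq_add_primL2
  have := integral_deriv_smul_eq (hasDerivAt_sin_nat_mul n) (by fun_prop) c g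
  simp_rw [mul_smul] at this
  rw [integral_smul, Real.sin_nat_mul_pi, mul_zero, Real.sin_zero, zero_smul, zero_smul, sub_zero,
    zero_sub, Complex.real_smul] at this
  rw [WeakThermo.inner_sinFrame, inner_cosFrame, eq_neg_of_add_eq_zero_left
    (a := ∫ x in Ioo 0 Real.pi, Real.sin (n * x) • g x) (add_eq_zero_iff_eq_neg'.2 this)]
  push_cast
  ring

theorem IsWeakDeriv.inner_cosFrame {f g : L2} (h : IsWeakDeriv f g) (hf : VanishesAtEnds f)
    (n : ℕ) : inner ℂ (cosFrame n) g = n * inner ℂ (sinFrame n) f := by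
  obtain ⟨c, rfl⟩ := h.exists_eq_add_primL2
  obtain ⟨rfl, hg⟩ := hf.of_eq
  have := integral_deriv_smul_eq (hasDerivAt_cos_nat_mul n) (by fun_prop) 0 g
  simp_rw [neg_smul, mul_smul] at this
  rw [integral_neg, integral_smul, hg, add_zero, smul_zero, smul_zero, sub_zero,
    zero_sub, neg_inj, Complex.real_smul] at this
  rw [WeakThermo.inner_cosFrame, WeakThermo.inner_sinFrame, ← this]
  push_cast
  ring

/-- f and the primitive of g have the same cosine coefficients for n ≠ 0, so they differ by a
constant. -/
theorem isWeakDeriv_of_inner {f g : L2}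
    (h : ∀ n : ℕ, inner ℂ (sinFrame n) g = -n * inner ℂ (cosFrame n) f) : IsWeakDeriv f g := by
  have hP := isWeakDeriv_primL2 g
  obtain ⟨d, hd⟩ : ∃ d : ℂ, f - primL2 g = d • cosFrame 0 := by
    refine ⟨inner ℂ (cosFrame 0) (f - primL2 g), isFrame_cosFrame.ext fun n => ?_⟩
    rw [inner_smul_right, inner_cosFrame_cosFrame]
    rcases eq_or_ne n 0 with rfl | hn
    · rw [if_pos rfl, mul_one]
    · have hn' : (-n : ℂ) ≠ 0 := by simpa using hn
      rw [if_neg hn, mul_zero, inner_sub_right, sub_eq_zero]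
      exact mul_left_cancel₀ hn' ((h n).symm.trans (hP.inner_sinFrame n))
  have hc : IsWeakDeriv (cosFrame 0) 0 := by
    have : cosFrame 0 = constL2 (trigScale 0) := by
      simp [cosFrame, constL2]
    rw [this]
    exact isWeakDeriv_constL2 _
  have := (hc.smul d).add hP
  rwa [← hd, sub_add_cancel, smul_zero, zero_add] at this

/-- The identity at n = 0 says ∫ g = 0, so the primitive of g vanishes at π as well as at 0. It then
has the same sine coefficients as f. -/
theorem isWeakDeriv_and_vanishesAtEnds_of_inner {f g : L2}
    (h : ∀ n : ℕ, inner ℂ (cosFrame n) g = n * inner ℂ (sinFrame n) f) :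
    IsWeakDeriv f g ∧ VanishesAtEnds f := by
  have hP := isWeakDeriv_primL2 g
  have hg : prim g Real.pi = 0 := by
    have := h 0
    rw [inner_cosFrame, Nat.cast_zero, Nat.cast_zero, zero_mul] at this
    have := (mul_eq_zero.1 this).resolve_left (by exact_mod_cast trigScale_ne_zero 0)
    rw [prim_pi]
    simpa using this
  have hv : VanishesAtEnds (primL2 g) :=
    ⟨prim g, (continuous_prim g).continuousOn, coeFn_ofContinuous _ _, prim_zero g, hg⟩
  obtain rfl : f = primL2 g := by
    refine isFrame_sinFrame.ext fun n => ?_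
    rcases eq_or_ne n 0 with rfl | hn
    · simp [sinFrame_zero]
    · have hn' : (n : ℂ) ≠ 0 := by simpa using hn
      exact mul_left_cancel₀ hn' ((h n).symm.trans (hP.inner_cosFrame hv n))
  exact ⟨hP, hv⟩

end WeakDerivatives

/-! ### Resolvents of the uncoupled wave and heat operators -/

section DecoupledResolvents

/-- The trigonometric frame adapted to a boundary condition. -/
noncomputable def BC.frame : BC → ℕ → L2
  | BC.dirichlet => sinFrame
  | BC.neumann => cosFrame

/-- The frame containing the derivatives of the members of `BC.frame`. -/
noncomputable def BC.dualFrame : BC → ℕ → L2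
  | BC.dirichlet => cosFrame
  | BC.neumann => sinFrame

/-- The sign in `e' = ± n ẽ`, for `e` in `BC.frame` and `ẽ` in `BC.dualFrame`. -/
def BC.sign : BC → ℂ
  | BC.dirichlet => 1
  | BC.neumann => -1

theorem BC.sign_mul_sign (b : BC) : b.sign * b.sign = 1 := by
  cases b <;> simp [BC.sign]

theorem BC.norm_sign (b : BC) : ‖b.sign‖ = 1 := by
  cases b <;> simp [BC.sign]

theorem BC.isFrame_frame (b : BC) : IsFrame b.frame := by
  cases b
  exacts [isFrame_sinFrame, isFrame_cosFrame]

theorem BC.isFrame_dualFrame (b : BC) : IsFrame b.dualFrame := by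
  cases b
  exacts [isFrame_cosFrame, isFrame_sinFrame]

theorem eq_zero_of_sinFrame_eq_zero {n : ℕ} (h : sinFrame n = 0) : n = 0 := by
  by_contra hn
  have := norm_sinFrame hn
  simp [h] at this

theorem cosFrame_ne_zero (n : ℕ) : cosFrame n ≠ 0 := fun h => by
  have := norm_cosFrame n
  simp [h] at this

theorem BC.eq_zero_of_frame (b : BC) {n : ℕ} (h : b.frame n = 0) : n = 0 := by
  cases b
  exacts [eq_zero_of_sinFrame_eq_zero h, absurd h (cosFrame_ne_zero n)]

theorem BC.eq_zero_of_dualFrame (b : BC) {n : ℕ} (h : b.dualFrame n = 0) : n = 0 := by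
  cases b
  exacts [absurd h (cosFrame_ne_zero n), eq_zero_of_sinFrame_eq_zero h]

/-- The boundary condition for a pair `v`, `w`, where `w` plays the role of the derivative
of `v`. -/
def BC.Pair : BC → L2 → L2 → Prop
  | BC.dirichlet, v, _ => VanishesAtEnds v
  | BC.neumann, _, w => VanishesAtEnds w

/-- The member of the pair that vanishes at the ends is expanded in sines, the other in cosines. The
coefficient identities then force the boundary condition too, so resolvent equations can be solved
one frequency at a time. -/
theorem isWeakDeriv_pair_iff (b : BC) (v w v' w' : L2) :
    (IsWeakDeriv v v' ∧ IsWeakDeriv w w' ∧ b.Pair v w) ↔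
      ∀ n : ℕ, inner ℂ (b.dualFrame n) v' = b.sign * n * inner ℂ (b.frame n) v ∧
        inner ℂ (b.frame n) w' = -(b.sign * n * inner ℂ (b.dualFrame n) w) := by
  cases b
  · simp only [BC.frame, BC.dualFrame, BC.sign, BC.Pair, one_mul]
    constructor
    · rintro ⟨hv, hw, hb⟩ n
      exact ⟨hv.inner_cosFrame hb n, by rw [hw.inner_sinFrame, neg_mul]⟩
    · intro h
      obtain ⟨hv, hb⟩ := isWeakDeriv_and_vanishesAtEnds_of_inner fun n => (h n).1
      exact ⟨hv, isWeakDeriv_of_inner fun n => by rw [(h n).2, neg_mul], hb⟩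
  · simp only [BC.frame, BC.dualFrame, BC.sign, BC.Pair, neg_mul, one_mul, neg_neg]
    constructor
    · rintro ⟨hv, hw, hb⟩ n
      exact ⟨by rw [hv.inner_sinFrame, neg_mul], hw.inner_cosFrame hb n⟩
    · intro h
      obtain ⟨hw, hb⟩ := isWeakDeriv_and_vanishesAtEnds_of_inner fun n => (h n).2
      exact ⟨isWeakDeriv_of_inner fun n => by rw [(h n).1, neg_mul], hw, hb⟩

theorem wave_symbol_ne_zero {μ : ℂ} {a : ℝ} (ha : 0 < a)
    (hμ : ∀ n : ℤ, a ≤ ‖μ - Complex.I * n‖) (n : ℕ) :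
    μ - Complex.I * n ≠ 0 ∧ μ + Complex.I * n ≠ 0 := by
  have h1 := hμ n
  have h2 := hμ (-n)
  push_cast at h1 h2
  rw [mul_neg, sub_neg_eq_add] at h2
  exact ⟨norm_pos_iff.1 (ha.trans_le h1), norm_pos_iff.1 (ha.trans_le h2)⟩

theorem wave_symbol_eq (μ : ℂ) (n : ℕ) :
    μ ^ 2 + (n : ℂ) ^ 2 = (μ - Complex.I * n) * (μ + Complex.I * n) := by
  linear_combination (n : ℂ) ^ 2 * Complex.I_sq

/-- By partial fractions both symbols are, up to a unimodular factor, half the sum or half the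
difference of 1/(μ - in) and 1/(μ + in). -/
theorem norm_wave_multiplier_le {μ : ℂ} {a : ℝ} (ha : 0 < a)
    (hμ : ∀ n : ℤ, a ≤ ‖μ - Complex.I * n‖) (n : ℕ) :
    ‖μ / (μ ^ 2 + (n : ℂ) ^ 2)‖ ≤ a⁻¹ ∧ ‖(n : ℂ) / (μ ^ 2 + (n : ℂ) ^ 2)‖ ≤ a⁻¹ := by
  obtain ⟨h1, h2⟩ := wave_symbol_ne_zero ha hμ n
  have n1 : ‖(μ - Complex.I * n)⁻¹‖ ≤ a⁻¹ := by
    rw [norm_inv]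
    exact inv_anti₀ ha (by simpa using hμ n)
  have n2 : ‖(μ + Complex.I * n)⁻¹‖ ≤ a⁻¹ := by
    rw [norm_inv]
    exact inv_anti₀ ha (by simpa using hμ (-n))
  rw [wave_symbol_eq]
  constructor
  · have : μ / ((μ - Complex.I * n) * (μ + Complex.I * n)) =
        ((μ - Complex.I * n)⁻¹ + (μ + Complex.I * n)⁻¹) / 2 := by
      field_simp
      ring
    rw [this, norm_div, Complex.norm_ofNat, div_le_iff₀ two_pos]
    exact (norm_add_le _ _).trans (by linarith)
  · have : (n : ℂ) / ((μ - Complex.I * n) * (μ + Complex.I * n)) =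
        ((μ - Complex.I * n)⁻¹ - (μ + Complex.I * n)⁻¹) / (2 * Complex.I) := by
      rw [inv_sub_inv h1 h2, div_div, ← mul_div_mul_right (n : ℂ) _
        (mul_ne_zero two_ne_zero Complex.I_ne_zero)]
      ring
    rw [this, norm_div, norm_mul, Complex.norm_ofNat, Complex.norm_I, mul_one,
      div_le_iff₀ two_pos]
    exact (norm_sub_le _ _).trans (by linarith)

/-- The resolvent of the wave operator `(w, v) ↦ (v', w')` as a matrix of multipliers. -/
theorem exists_wave_resolvent (b : BC) {μ : ℂ} {a : ℝ} (ha : 0 < a)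
    (hμ : ∀ n : ℤ, a ≤ ‖μ - Complex.I * n‖) :
    ∃ A₀₀ A₀₁ A₁₀ A₁₁ : L2 →L[ℂ] L2, (∀ f, ‖A₀₁ f‖ ≤ a⁻¹ * ‖f‖) ∧ (∀ f, ‖A₁₁ f‖ ≤ a⁻¹ * ‖f‖) ∧
      ∀ f g w v : L2, (w = A₀₀ f + A₀₁ g ∧ v = A₁₀ f + A₁₁ g) ↔
        ∃ v' w', IsWeakDeriv v v' ∧ IsWeakDeriv w w' ∧ b.Pair v w ∧
          μ • w - v' = f ∧ μ • v - w' = g := by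
  have ha' : 0 ≤ a⁻¹ := by positivity
  have hq : ∀ n : ℕ, μ ^ 2 + (n : ℂ) ^ 2 ≠ 0 := fun n => by
    rw [wave_symbol_eq]
    exact mul_ne_zero (wave_symbol_ne_zero ha hμ n).1 (wave_symbol_ne_zero ha hμ n).2
  have hd : ∀ n : ℕ, ‖μ / (μ ^ 2 + (n : ℂ) ^ 2)‖ ≤ a⁻¹ := fun n =>
    (norm_wave_multiplier_le ha hμ n).1
  have ho : ∀ n : ℕ, ‖b.sign * ((n : ℂ) / (μ ^ 2 + (n : ℂ) ^ 2))‖ ≤ a⁻¹ := fun n => by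
    rw [norm_mul, b.norm_sign, one_mul]
    exact (norm_wave_multiplier_le ha hμ n).2
  -- The coupling enters the wave block only through the v equation, so norm bounds are kept only
  -- for the two entries that act on g.
  obtain ⟨A₀₀, -, h₀₀⟩ := b.isFrame_dualFrame.exists_multiplier b.isFrame_dualFrame ha' hd
    fun n h => .inr h
  obtain ⟨A₁₁, n₁₁, h₁₁⟩ := b.isFrame_frame.exists_multiplier b.isFrame_frame ha' hd
    fun n h => .inr h
  -- The factor n makes the off-diagonal symbol vanish at index 0, the only index where a frame
  -- member can be zero.
  obtain ⟨A₀₁, n₀₁, h₀₁⟩ := b.isFrame_frame.exists_multiplier b.isFrame_dualFrame ha' ho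
    fun n h => .inl (by simp [b.eq_zero_of_dualFrame h])
  obtain ⟨A₁₀, -, h₁₀⟩ := b.isFrame_dualFrame.exists_multiplier b.isFrame_frame ha' ho
    fun n h => .inl (by simp [b.eq_zero_of_frame h])
  refine ⟨A₀₀, A₀₁, -A₁₀, A₁₁, n₀₁, n₁₁, fun f g w v => ⟨?_, ?_⟩⟩
  · rintro ⟨hw, hv⟩
    refine ⟨μ • w - f, μ • v - g, ?_⟩
    rw [← and_assoc, ← and_assoc, and_assoc (a := IsWeakDeriv v _), isWeakDeriv_pair_iff]
    refine ⟨fun n => ?_, by simp, by simp⟩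
    have hn := hq n
    rw [inner_sub_right, inner_sub_right, inner_smul_right, inner_smul_right, hw, hv,
      inner_add_right, inner_add_right, neg_apply, inner_neg_right,
      h₀₀, h₀₁, h₁₀, h₁₁]
    constructor
    · field_simp
      linear_combination (n : ℂ) ^ 2 * inner ℂ (b.dualFrame n) f * b.sign_mul_sign
    · field_simp
      linear_combination (n : ℂ) ^ 2 * inner ℂ (b.frame n) g * b.sign_mul_sign
  · rintro ⟨v', w', hv, hw, hb, rfl, rfl⟩
    have h := (isWeakDeriv_pair_iff b v w v' w').1 ⟨hv, hw, hb⟩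
    constructor
    · refine b.isFrame_dualFrame.ext fun n => ?_
      have hn := hq n
      rw [inner_add_right, h₀₀, h₀₁, inner_sub_right, inner_sub_right, inner_smul_right,
        inner_smul_right, (h n).1, (h n).2]
      field_simp
      linear_combination -(n : ℂ) ^ 2 * inner ℂ (b.dualFrame n) w * b.sign_mul_sign
    · refine b.isFrame_frame.ext fun n => ?_
      have hn := hq n
      rw [inner_add_right, neg_apply, inner_neg_right, h₁₀, h₁₁,
        inner_sub_right, inner_sub_right, inner_smul_right, inner_smul_right, (h n).1, (h n).2]
      field_simp
      linear_combination -(n : ℂ) ^ 2 * inner ℂ (b.frame n) v * b.sign_mul_sign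

/-- The resolvent of the heat operator `θ ↦ θ''` as a multiplier. -/
theorem exists_heat_resolvent (b : BC) {μ : ℂ} {d : ℝ} (hd : 0 < d)
    (hμ : ∀ n : ℕ, d ≤ ‖μ - (-(n : ℂ) ^ 2)‖) :
    ∃ A : L2 →L[ℂ] L2, (∀ f, ‖A f‖ ≤ d⁻¹ * ‖f‖) ∧
      ∀ f θ : L2, θ = A f ↔
        ∃ p q, IsWeakDeriv θ p ∧ IsWeakDeriv p q ∧ b.Pair θ p ∧ μ • θ - q = f := by
  have hd' : 0 ≤ d⁻¹ := by positivity
  simp only [sub_neg_eq_add] at hμ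
  have hq : ∀ n : ℕ, μ + (n : ℂ) ^ 2 ≠ 0 := fun n => norm_pos_iff.1 (hd.trans_le (hμ n))
  have h1 : ∀ n : ℕ, ‖1 / (μ + (n : ℂ) ^ 2)‖ ≤ d⁻¹ := fun n => by
    rw [norm_div, norm_one, one_div]
    exact inv_anti₀ hd (hμ n)
  -- This symbol produces θ' from the data. Any bound will do; this one comes from n ≤ n² ≤ |μ + n²|
  -- + |μ| and d ≤ |μ + n²|.
  have h2 : ∀ n : ℕ, ‖b.sign * ((n : ℂ) / (μ + (n : ℂ) ^ 2))‖ ≤ 1 + ‖μ‖ * d⁻¹ := fun n => by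
    rw [norm_mul, b.norm_sign, one_mul, norm_div, Complex.norm_natCast]
    have hpos : 0 < ‖μ + (n : ℂ) ^ 2‖ := hd.trans_le (hμ n)
    rw [div_le_iff₀ hpos]
    have e1 : (n : ℝ) ≤ (n : ℝ) ^ 2 := by
      exact_mod_cast Nat.le_self_pow two_ne_zero n
    have e2 : (n : ℝ) ^ 2 ≤ ‖μ + (n : ℂ) ^ 2‖ + ‖μ‖ := by
      have := norm_sub_le (μ + (n : ℂ) ^ 2) μ
      simpa using this
    have e3 : ‖μ‖ ≤ ‖μ‖ * d⁻¹ * ‖μ + (n : ℂ) ^ 2‖ := by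
      rw [mul_assoc]
      refine le_mul_of_one_le_right (norm_nonneg _) ?_
      rw [inv_mul_eq_div, one_le_div hd]
      exact hμ n
    nlinarith
  obtain ⟨A, nA, hA⟩ := b.isFrame_frame.exists_multiplier b.isFrame_frame hd' h1 fun n h => .inr h
  obtain ⟨P, -, hP⟩ := b.isFrame_frame.exists_multiplier b.isFrame_dualFrame (by positivity) h2
    fun n h => .inl (by simp [b.eq_zero_of_dualFrame h])
  refine ⟨A, nA, fun f θ => ⟨?_, ?_⟩⟩
  · rintro rfl
    refine ⟨P f, μ • A f - f, ?_⟩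
    rw [← and_assoc, ← and_assoc, and_assoc (a := IsWeakDeriv (A f) _), isWeakDeriv_pair_iff]
    refine ⟨fun n => ?_, by simp⟩
    have hn := hq n
    rw [inner_sub_right, inner_smul_right, hA, hP]
    constructor
    · field_simp
    · field_simp
      linear_combination (n : ℂ) ^ 2 * inner ℂ (b.frame n) f * b.sign_mul_sign
  · rintro ⟨p, q, hθ, hp, hb, rfl⟩
    have h := (isWeakDeriv_pair_iff b θ p p q).1 ⟨hθ, hp, hb⟩
    refine b.isFrame_frame.ext fun n => ?_
    have hn := hq n
    rw [hA, inner_sub_right, inner_smul_right, (h n).2, (h n).1]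
    field_simp
    linear_combination -(n : ℂ) ^ 2 * inner ℂ (b.frame n) θ * b.sign_mul_sign

end DecoupledResolvents

/-! ### The coupling as a perturbation -/

section Perturbation

/-- The operator into the state space with given components. -/
noncomputable def stateMap (A₀ A₁ A₂ : State →L[ℂ] L2) : State →L[ℂ] State :=
  (PiLp.continuousLinearEquiv 2 ℂ fun _ : Fin 3 => L2).symm.toContinuousLinearMap ∘L
    ContinuousLinearMap.pi ![A₀, A₁, A₂]

theorem state_ext {y z : State} (h₀ : y 0 = z 0) (h₁ : y 1 = z 1) (h₂ : y 2 = z 2) : y = z := by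
  refine PiLp.ext fun i => ?_
  fin_cases i
  exacts [h₀, h₁, h₂]

noncomputable def component (i : Fin 3) : State →L[ℂ] L2 := PiLp.proj 2 (fun _ : Fin 3 => L2) i

/-- The coupling `(w, v, θ) ↦ (0, -θ, v)`. -/
noncomputable def coupling : State →L[ℂ] State := stateMap 0 (-component 2) (component 1)

/-- With the coupling terms moved to the right-hand side, the resolvent equation becomes one wave
and one heat problem of the kind already solved. -/
theorem mem_generator_domain_iff {bu bθ : BC} {γ : ℝ} {μ : ℂ} {z f : State} :
    (∃ h : z ∈ (generator bu bθ γ).domain, μ • z - generator bu bθ γ ⟨z, h⟩ = f) ↔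
      (∃ v' w', IsWeakDeriv (z 1) v' ∧ IsWeakDeriv (z 0) w' ∧ bu.Pair (z 1) (z 0) ∧
        μ • z 0 - v' = f 0 ∧ μ • z 1 - w' = f 1 - (γ : ℂ) • z 2) ∧
      ∃ p q, IsWeakDeriv (z 2) p ∧ IsWeakDeriv p q ∧ bθ.Pair (z 2) p ∧
        μ • z 2 - q = f 2 + (γ : ℂ) • z 1 := by
  have hu : DisplacementBC bu z ↔ bu.Pair (z 1) (z 0) := by cases bu <;> rfl
  have hθ : TemperatureBC bθ z ↔ bθ.Pair (z 2) (D (z 2)) := by cases bθ <;> rfl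
  constructor
  · rintro ⟨h, rfl⟩
    obtain ⟨h0, h1, h2, hbu, hbθ⟩ := h
    refine ⟨⟨D (z 1), D (z 0), isWeakDeriv_D h1, isWeakDeriv_D h0, hu.1 hbu, rfl, ?_⟩,
      D (z 2), D (D (z 2)), isWeakDeriv_D h2.1, isWeakDeriv_D h2.2, hθ.1 hbθ, ?_⟩
    · change _ = μ • z 1 - (D (z 0) - (γ : ℂ) • z 2) - (γ : ℂ) • z 2
      abel
    · change _ = μ • z 2 - ((γ : ℂ) • z 1 + D (D (z 2))) + (γ : ℂ) • z 1
      abel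
  · rintro ⟨⟨v', w', hv, hw, hbu, e0, e1⟩, p, q, hp, hq, hbθ, e2⟩
    have hD := hp.D_eq
    refine ⟨⟨⟨w', hw⟩, ⟨v', hv⟩, ⟨⟨p, hp⟩, ⟨q, hD ▸ hq⟩⟩, hu.2 hbu, hθ.2 (hD ▸ hbθ)⟩,
      state_ext ?_ ?_ ?_⟩
    · change μ • z 0 - D (z 1) = f 0
      rw [hv.D_eq, e0]
    · change μ • z 1 - (D (z 0) - (γ : ℂ) • z 2) = f 1
      rw [hw.D_eq, ← sub_add, e1, sub_add_cancel]
    · change μ • z 2 - ((γ : ℂ) • z 1 + D (D (z 2))) = f 2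
      rw [hD, hq.D_eq, add_comm, ← sub_sub, e2, add_sub_cancel_right]

/-- 1 - K² = (1 - K)(1 + K) is invertible by a Neumann series, and its factors commute. A bound on K
itself is not needed, which matters because K need not be small when only one of a, d is large. -/
theorem isUnit_one_sub_of_norm_sq_le {E : Type*} [NormedAddCommGroup E] [NormedSpace ℂ E]
    [CompleteSpace E] (K : E →L[ℂ] E) {r : ℝ} (hr0 : 0 ≤ r) (hr : r < 1)
    (hK : ∀ z, ‖K (K z)‖ ≤ r * ‖z‖) : IsUnit (1 - K) := by
  have hn : ‖K * K‖ < 1 := (ContinuousLinearMap.opNorm_le_bound _ hr0 hK).trans_lt hr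
  have hc : Commute (1 - K) (1 + K) :=
    (Commute.one_right _).add_right ((Commute.one_left K).sub_left rfl)
  have h := isUnit_one_sub_of_norm_lt_one hn
  have e : 1 - K * K = (1 - K) * (1 + K) := by noncomm_ring
  rw [e, hc.isUnit_mul_iff] at h
  exact h.1

/-- Only the product of the two distances matters, since `K` alternates between the wave and heat
blocks. -/
theorem mem_resolventSetOf_generator (bu bθ : BC) (γ : ℝ) {μ : ℂ} {a d : ℝ} (ha : 0 < a)
    (hd : 0 < d) (hμa : ∀ n : ℤ, a ≤ ‖μ - Complex.I * n‖)
    (hμd : ∀ n : ℕ, d ≤ ‖μ - (-(n : ℂ) ^ 2)‖) (had : 2 * γ ^ 2 < a * d) :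
    μ ∈ resolventSetOf (generator bu bθ γ) := by
  obtain ⟨A₀₀, A₀₁, A₁₀, A₁₁, n₀₁, n₁₁, hA⟩ := exists_wave_resolvent bu ha hμa
  obtain ⟨A₂₂, n₂₂, hA₂⟩ := exists_heat_resolvent bθ hd hμd
  let R₀ : State →L[ℂ] State := stateMap (A₀₀ ∘L component 0 + A₀₁ ∘L component 1)
    (A₁₀ ∘L component 0 + A₁₁ ∘L component 1) (A₂₂ ∘L component 2)
  let K : State →L[ℂ] State := R₀ ∘L ((γ : ℂ) • coupling)
  -- Domain membership and the resolvent equation together amount to the fixed point equation z = R₀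
  -- (f + γ C z).
  have key : ∀ z f : State,
      (∃ h : z ∈ (generator bu bθ γ).domain, μ • z - generator bu bθ γ ⟨z, h⟩ = f) ↔
        (1 - K) z = R₀ f := by
    intro z f
    rw [mem_generator_domain_iff, ← hA, ← hA₂]
    have e : (1 - K) z = R₀ f ↔ z = R₀ (f + (γ : ℂ) • coupling z) := by
      rw [map_add]
      exact sub_eq_iff_eq_add
    have c0 : (f + (γ : ℂ) • coupling z) 0 = f 0 := by
      change f 0 + (γ : ℂ) • (0 : L2) = f 0
      rw [smul_zero, add_zero]
    have c1 : (f + (γ : ℂ) • coupling z) 1 = f 1 - (γ : ℂ) • z 2 := by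
      change f 1 + (γ : ℂ) • (-z 2) = _
      rw [smul_neg, sub_eq_add_neg]
    have c2 : (f + (γ : ℂ) • coupling z) 2 = f 2 + (γ : ℂ) • z 1 := rfl
    rw [e, ← c1, ← c2, ← c0]
    constructor
    · rintro ⟨⟨h0, h1⟩, h2⟩
      exact state_ext h0 h1 h2
    · intro h
      exact ⟨⟨congrArg (fun y : State => y 0) h, congrArg (fun y : State => y 1) h⟩,
        congrArg (fun y : State => y 2) h⟩
  have hK0 : ∀ z, K z 0 = (γ : ℂ) • A₀₁ (-z 2) := fun z => by
    change A₀₀ ((γ : ℂ) • (0 : L2)) + A₀₁ ((γ : ℂ) • (-z 2)) = _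
    rw [smul_zero, map_zero, zero_add, map_smul]
  have hK1 : ∀ z, K z 1 = (γ : ℂ) • A₁₁ (-z 2) := fun z => by
    change A₁₀ ((γ : ℂ) • (0 : L2)) + A₁₁ ((γ : ℂ) • (-z 2)) = _
    rw [smul_zero, map_zero, zero_add, map_smul]
  have hK2 : ∀ z, K z 2 = (γ : ℂ) • A₂₂ (z 1) := fun z => by
    change A₂₂ ((γ : ℂ) • z 1) = _
    rw [map_smul]
  set q : ℝ := γ ^ 2 * (a⁻¹ * d⁻¹) with hq
  have hq0 : 0 ≤ q := by positivity
  have hq1 : 2 * q < 1 := by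
    rw [hq, ← mul_inv, ← mul_assoc, ← div_eq_mul_inv, div_lt_one (mul_pos ha hd)]
    exact had
  have hγ : ‖(γ : ℂ)‖ * ‖(γ : ℂ)‖ = γ ^ 2 := by
    rw [Complex.norm_real, Real.norm_eq_abs, abs_mul_abs_self, sq]
  have bound : ∀ (S T : L2 →L[ℂ] L2) {s t : ℝ}, 0 ≤ s → (∀ f, ‖S f‖ ≤ s * ‖f‖) →
      (∀ f, ‖T f‖ ≤ t * ‖f‖) → ∀ f, ‖(γ : ℂ) • S ((γ : ℂ) • T f)‖ ≤ γ ^ 2 * (s * t) * ‖f‖ := by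
    intro S T s t hs hS hT f
    rw [map_smul, smul_smul, norm_smul, norm_mul, hγ, mul_assoc, mul_assoc]
    exact mul_le_mul_of_nonneg_left ((hS _).trans (mul_le_mul_of_nonneg_left (hT f) hs))
      (sq_nonneg γ)
  have ha' : 0 ≤ a⁻¹ := by positivity
  have hd' : 0 ≤ d⁻¹ := by positivity
  -- Each of the three components is at most q ‖z‖, so the norm is at most √3 q ‖z‖; the factor 2
  -- rounds √3 up.
  have hKK : ∀ z, ‖K (K z)‖ ≤ 2 * q * ‖z‖ := by
    intro z
    have hz : ∀ i, ‖z i‖ ≤ ‖z‖ := fun i => PiLp.norm_apply_le z i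
    have b0 : ‖K (K z) 0‖ ≤ q * ‖z‖ := by
      rw [hK0, hK2, map_neg, smul_neg, norm_neg]
      exact (bound A₀₁ A₂₂ ha' n₀₁ n₂₂ _).trans (mul_le_mul_of_nonneg_left (hz 1) hq0)
    have b1 : ‖K (K z) 1‖ ≤ q * ‖z‖ := by
      rw [hK1, hK2, map_neg, smul_neg, norm_neg]
      exact (bound A₁₁ A₂₂ ha' n₁₁ n₂₂ _).trans (mul_le_mul_of_nonneg_left (hz 1) hq0)
    have b2 : ‖K (K z) 2‖ ≤ q * ‖z‖ := by
      rw [hK2, hK1, map_neg, smul_neg, map_neg, smul_neg, norm_neg, hq, mul_comm a⁻¹]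
      refine (bound A₂₂ A₁₁ hd' n₂₂ n₁₁ _).trans (mul_le_mul_of_nonneg_left (hz 2) ?_)
      positivity
    have h : ‖K (K z)‖ ^ 2 = ‖K (K z) 0‖ ^ 2 + ‖K (K z) 1‖ ^ 2 + ‖K (K z) 2‖ ^ 2 := by
      rw [PiLp.norm_sq_eq_of_L2, Fin.sum_univ_three]
    have s0 := pow_le_pow_left₀ (norm_nonneg _) b0 2
    have s1 := pow_le_pow_left₀ (norm_nonneg _) b1 2
    have s2 := pow_le_pow_left₀ (norm_nonneg _) b2 2
    refine (pow_le_pow_iff_left₀ (norm_nonneg _) (by positivity) two_ne_zero).1 ?_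
    have : (2 * q * ‖z‖) ^ 2 = 4 * (q * ‖z‖) ^ 2 := by ring
    rw [this, h]
    linarith [sq_nonneg (q * ‖z‖)]
  obtain ⟨U, hU⟩ := isUnit_one_sub_of_norm_sq_le K (by positivity) hq1 hKK
  have hU1 : ∀ z, (1 - K) ((↑U⁻¹ : State →L[ℂ] State) z) = z := fun z => by
    rw [← hU, ← mul_apply_eq_comp, Units.mul_inv, one_apply_eq_self]
  have hU2 : ∀ z, (↑U⁻¹ : State →L[ℂ] State) ((1 - K) z) = z := fun z => by
    rw [← hU, ← mul_apply_eq_comp, Units.inv_mul, one_apply_eq_self]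
  -- The resolvent is (1 - K)⁻¹ R₀; the two directions of `key` give the right and the left inverse
  -- property.
  refine ⟨(↑U⁻¹ : State →L[ℂ] State) ∘L R₀, fun f => (key _ f).2 (hU1 _), fun z => ?_⟩
  rw [ContinuousLinearMap.comp_apply, ← (key z _).1 ⟨z.2, rfl⟩, hU2]

end Perturbation

/-! ### Localization of the spectrum far from the origin -/

/-- Far from the origin, the distances to the imaginary axis and to the negative real axis are
not both small. -/
theorem norm_le_or_norm_le {μ : ℂ} {r : ℝ} (h : 2 * r ≤ ‖μ‖) :
    (∀ n : ℤ, r ≤ ‖μ - Complex.I * n‖) ∨ ∀ n : ℕ, r ≤ ‖μ - (-(n : ℂ) ^ 2)‖ := by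
  -- As |μ| ≤ |Re μ| + |Im μ|, one of the two parts is at least r; it bounds the distance to the
  -- imaginary or to the real axis.
  rcases le_or_gt r |μ.re| with hr | hr
  · refine .inl fun n => hr.trans ?_
    simpa using Complex.abs_re_le_norm (μ - Complex.I * n)
  · refine .inr fun n => ?_
    have h1 : r ≤ |μ.im| := by linarith [Complex.norm_le_abs_re_add_abs_im μ]
    refine h1.trans ?_
    have : (μ - (-(n : ℂ) ^ 2)).im = μ.im := by
      have : (-(n : ℂ) ^ 2) = ((-(n : ℝ) ^ 2 : ℝ) : ℂ) := by push_cast; rfl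
      rw [this, Complex.sub_im, Complex.ofReal_im, sub_zero]
    rw [← this]
    exact Complex.abs_im_le_norm _

theorem norm_div_sub_one_lt {μ ν : ℂ} {ε : ℝ} (hν : 1 ≤ ‖ν‖) (h : ‖μ - ν‖ < ε) :
    ‖μ / ν - 1‖ < ε := by
  have hν0 : ν ≠ 0 := norm_pos_iff.1 (zero_lt_one.trans_le hν)
  rw [div_sub_one hν0, norm_div]
  exact (div_le_self (norm_nonneg _) hν).trans_lt h

end WeakThermo

theorem theorem4p3 (bu bθ : WeakThermo.BC) (γ : ℝ) (hγ : 0 < γ) :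
    ∀ ε : ℝ, 0 < ε → ∀ N : ℕ, ∃ R : ℝ,
      ∀ μ ∈ WeakThermo.spectrumOf (WeakThermo.generator bu bθ γ), R ≤ ‖μ‖ →
        (∃ n : ℤ, (N : ℤ) ≤ |n| ∧ n ≠ 0 ∧
          ‖μ - Complex.I * n‖ < ε ∧ ‖μ / (Complex.I * n) - 1‖ < ε) ∨
        (∃ n : ℕ, N ≤ n ∧ n ≠ 0 ∧
          ‖μ - (-(n : ℂ) ^ 2)‖ < ε ∧ ‖μ / (-(n : ℂ) ^ 2) - 1‖ < ε) := by
  intro ε hε N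
  -- Chosen so that 2γ² < r ε: one distance at least r and the other at least ε suffice for
  -- invertibility.
  set r : ℝ := 2 * γ ^ 2 / ε + 1 with hr
  have hr0 : 0 < r := by positivity
  have hrε : 2 * γ ^ 2 < r * ε := by
    rw [hr, add_mul, div_mul_cancel₀ _ hε.ne']
    linarith
  -- The term 2r serves `norm_le_or_norm_le`. The rest forces any ν within ε of μ to satisfy |ν| ≥
  -- (N + 1)², whence |n| ≥ N + 1 for ν = in and for ν = -n². In particular n ≠ 0 and |ν| ≥ 1, so
  -- the relative error is below ε as well.
  refine ⟨2 * r + ((N : ℝ) + 1) ^ 2 + ε, fun μ hμ hR => ?_⟩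
  have hN : (0 : ℝ) ≤ N := N.cast_nonneg
  have hnear : ∀ ν : ℂ, ‖μ - ν‖ < ε → ((N : ℝ) + 1) ^ 2 ≤ ‖ν‖ := fun ν h => by
    have := norm_le_norm_add_norm_sub ν μ
    rw [norm_sub_rev] at this
    linarith
  by_cases h1 : ∃ n : ℤ, ‖μ - Complex.I * n‖ < ε
  · obtain ⟨n, hn⟩ := h1
    have hn' := hnear _ hn
    have hnorm : ‖Complex.I * (n : ℂ)‖ = ((|n| : ℤ) : ℝ) := by
      rw [norm_mul, Complex.norm_I, one_mul, Complex.norm_intCast, Int.cast_abs]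
    rw [hnorm] at hn'
    have hle : (N : ℤ) + 1 ≤ |n| := by
      have : (N : ℝ) + 1 ≤ ((|n| : ℤ) : ℝ) := by nlinarith
      exact_mod_cast this
    refine .inl ⟨n, by omega, ?_, hn, WeakThermo.norm_div_sub_one_lt ?_ hn⟩
    · rintro rfl
      simp only [abs_zero] at hle
      omega
    · rw [hnorm]
      nlinarith
  by_cases h2 : ∃ n : ℕ, ‖μ - (-(n : ℂ) ^ 2)‖ < ε
  · obtain ⟨n, hn⟩ := h2
    have hn' := hnear _ hn
    have hnorm : ‖-(n : ℂ) ^ 2‖ = (n : ℝ) ^ 2 := by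
      rw [norm_neg, norm_pow, Complex.norm_natCast]
    have hle : N + 1 ≤ n := by
      rw [hnorm] at hn'
      have : (N : ℝ) + 1 ≤ n :=
        (pow_le_pow_iff_left₀ (by positivity) n.cast_nonneg two_ne_zero).1 hn'
      exact_mod_cast this
    refine .inr ⟨n, by omega, by omega, hn, WeakThermo.norm_div_sub_one_lt ?_ hn⟩
    nlinarith
  push Not at h1 h2
  refine absurd ?_ hμ
  -- The two cases exchange the roles of r and ε as lower bounds for the two distances.
  rcases WeakThermo.norm_le_or_norm_le (μ := μ) (r := r) (by nlinarith) with h | h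
  · exact WeakThermo.mem_resolventSetOf_generator bu bθ γ hr0 hε h h2 hrε
  · exact WeakThermo.mem_resolventSetOf_generator bu bθ γ hε hr0 h1 h (mul_comm r ε ▸ hrε)
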